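/- **Setting.** Let $(V,\eta)$ be a Lorentzian vector space with $\dim V>2$, let $S$ be a finite-dimensional (possibly $N$-extended) real spinor module, i.e. a real module of the even Clifford algebra of $(V,\eta)$, on which $A\in\mathfrak{so}(V)$ acts by $s\mapsto A\cdot s$, and let $\kappa:\bigodot^2S\to V$ be a causal symmetric Dirac current: an $\mathfrak{so}(V)$-equivariant symmetric bilinear map such that for every $s\neq0$ the vector $\kappa_s:=\kappa(s,s)$ is time-like or null (in particular non-zero). Let $\mathfrak r$ be the Lie algebra of all $\mathfrak{so}(V)$-equivariant $a\in\operatorname{End}S$ with $\kappa(as,t)+\kappa(s,at)=0$, and let $\widehat{\mathfrak s}=V\oplus S\oplus(\mathfrak{so}(V)\oplus\mathfrak r)$ (degrees $-2,-1,0$) be the graded Lie superalgebra with brackets $[A,B]=AB-BA$, $[a,b]=ab-ba$, $[A,a]=0$, $[A,v]=Av$, $[a,v]=0$, $[A,s]=A\cdot s$, $[a,s]=as$, $[s,s]=\kappa_s$, $[v,s]=0$, $[v,w]=0$. Fix a splitting $\bigodot^2S\cong V\oplus\ker\kappa$ of $\mathfrak{so}(V)\oplus\mathfrak r$-modules. Let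 $\mathfrak a=V\oplus S'\oplus(\mathfrak h\oplus\mathfrak r')$ be a graded subalgebra of $\widehat{\mathfrak s}$ ($S'\subseteq S$ a subspace, $\mathfrak h\subseteq\mathfrak{so}(V)$ and $\mathfrak r'\subseteq\mathfrak r$ subalgebras preserving $S'$), which is highly supersymmetric ($\dim S'>\tfrac12\dim S$) and transitive ($\mathfrak r'$ acts faithfully on $S'$). Put $\mathfrak a_0=\mathfrak h\oplus\mathfrak r'$ and $\mathfrak a_-=V\oplus S'$. For a graded subalgebra $\mathfrak b\supseteq\mathfrak a$ of the same form, with degree $-1$ part $S_{\mathfrak b}$ and degree $0$ part $\mathfrak h_{\mathfrak b}\oplus\mathfrak r_{\mathfrak b}$ (only $\mathfrak b=\mathfrak a$ and $\mathfrak b=\widehat{\mathfrak s}$ are needed), the Spencer $(2,2)$-cocycles of $\mathfrak a_-$ with values in $\mathfrak b$ are the sums $\alpha+\beta+\gamma+\rho$ of maps $\alpha:\bigwedge^2V\to V$, $\beta:V\otimes S'\to S_{\mathfrak b}$, $\gamma:\bigodot^2S'\to\mathfrak h_{\mathfrak b}$, $\rho:\bigodot^2S'\to\mathfrak r_{\mathfrak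 b}$ with $$\alpha(\kappa_s,v)+2\kappa(s,\beta(v,s))+\gamma(s,s)v=0,\qquad \beta(\kappa_s,s)+\gamma(s,s)\cdot s+\rho(s,s)s=0 .$$ For $\lambda=\lambda_1+\lambda_2$ with $\lambda_1:V\to\mathfrak h_{\mathfrak b}$, $\lambda_2:V\to\mathfrak r_{\mathfrak b}$, the coboundary $\partial\lambda$ has components $\lambda_1(v)w-\lambda_1(w)v$, $\lambda_1(v)\cdot s+\lambda_2(v)s$, $-\lambda_1(\kappa_s)$, $-\lambda_2(\kappa_s)$, and $\mathsf H^{2,2}(\mathfrak a_-;\mathfrak b)$ is cocycles modulo coboundaries. Let $\widehat{\mathcal H}^{2,2}$ be the space of cocycles $\widehat\beta+\widehat\gamma+\widehat\rho$ of $\widehat{\mathfrak s}_-=V\oplus S$ with values in $\widehat{\mathfrak s}$ that have $\alpha=0$ and for which $\widehat\rho$ vanishes on the copy of $V$ in $\bigodot^2S$. Write $i_*$ for composition with the inclusion $\mathfrak a\hookrightarrow\widehat{\mathfrak s}$ and $i^*$ for restriction of cochains from $\widehat{\mathfrak s}_-$ to $\mathfrak a_-$. A class $[\alpha+\beta+\gamma+\rho]\in\mathsf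 H^{2,2}(\mathfrak a_-;\mathfrak a)$ is *admissible* if $i_*[\alpha+\beta+\gamma+\rho]=i^*[\widehat\beta+\widehat\gamma+\widehat\rho]$ in $\mathsf H^{2,2}(\mathfrak a_-;\widehat{\mathfrak s})$ for some $\mathfrak a_0$-invariant $\widehat\beta+\widehat\gamma+\widehat\rho\in\widehat{\mathcal H}^{2,2}$; then $i_*(\alpha+\beta+\gamma+\rho)=i^*(\widehat\beta+\widehat\gamma+\widehat\rho)+\partial\lambda$ for some linear $\lambda=\lambda_1+\lambda_2:V\to\mathfrak{so}(V)\oplus\mathfrak r$. With $X\cdot$ denoting the natural action of $X\in\mathfrak{so}(V)\oplus\mathfrak r$ on multilinear maps, put $$\Theta_1(v,s,s)=2\widehat\gamma(s,\widehat\beta(v,s))-(\lambda_1(v)\cdot\widehat\gamma)(s,s)-(\lambda_2(v)\cdot\widehat\gamma)(s,s),$$ $$\Theta_2(v,s,s)=2\widehat\rho(s,\widehat\beta(v,s))-(\lambda_1(v)\cdot\widehat\rho)(s,s)-(\lambda_2(v)\cdot\widehat\rho)(s,s)\qquad(s\in S').$$ The class is *integrable* if, for some representative and some such $\widehat\beta+\widehat\gamma+\widehat\rho$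 and $\lambda$, (i) $\Theta_1$ and $\Theta_2$ vanish on $V\otimes\ker(\kappa|_{\bigodot^2S'})$, and (ii) the maps $\widetilde\theta_1,\widetilde\theta_2$ on $V\times V$, with values in $\mathfrak{so}(V)$ and $\mathfrak r$, defined by $\widetilde\theta_i(v,\kappa_s)=\Theta_i(v,s,s)$ satisfy, for all $v,w\in V$, $s\in S'$, $$\widetilde\theta_1(v,w)\cdot s+\widetilde\theta_2(v,w)s=\widehat\beta(v,\widehat\beta(w,s))-\widehat\beta(w,\widehat\beta(v,s))+(\lambda(v)\cdot\widehat\beta)(w,s)-(\lambda(w)\cdot\widehat\beta)(v,s).$$ **Theorem.** Let $[\alpha+\beta+\gamma+\rho]\in\mathsf H^{2,2}(\mathfrak a_-;\mathfrak a)$ be admissible and integrable, and let $i_*(\alpha+\beta+\gamma+\rho)=i^*(\widehat\beta+\widehat\gamma+\widehat\rho)+\partial\lambda$ with $\widehat\beta+\widehat\gamma+\widehat\rho\in(\widehat{\mathcal H}^{2,2})^{\mathfrak a_0}$ and $\lambda=\lambda_1+\lambda_2:V\to\mathfrak{so}(V)\oplus\mathfrak r$ linear. Then there are unique bilinear maps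 $\widetilde\theta_1:V\times V\to\mathfrak{so}(V)$, $\widetilde\theta_2:V\times V\to\mathfrak r$ with $\widetilde\theta_i(v,\kappa_s)=\Theta_i(v,s,s)$ for all $v\in V$, $s\in S'$; they are alternating; and the brackets $$[A,B]=AB-BA,\quad [a,b]=ab-ba,\quad [A,a]=0,\quad [A,s]=A\cdot s,\quad [a,s]=as,$$ $$[A,v]=Av+\big([A,\lambda_1(v)]-\lambda_1(Av)\big)-\lambda_2(Av),\qquad [a,v]=[a,\lambda_2(v)],$$ $$[s,s]=\kappa_s+\big(\widehat\gamma(s,s)-\lambda_1(\kappa_s)\big)+\big(\widehat\rho(s,s)-\lambda_2(\kappa_s)\big),\qquad [v,s]=\widehat\beta(v,s)+\lambda_1(v)\cdot s+\lambda_2(v)s,$$ $$[v,w]=\alpha(v,w)+\big(\widetilde\theta_1(v,w)-\lambda_1(\alpha(v,w))+[\lambda_1(v),\lambda_1(w)]\big)+\big(\widetilde\theta_2(v,w)-\lambda_2(\alpha(v,w))+[\lambda_2(v),\lambda_2(w)]\big),$$ where $\alpha(v,w)=\lambda_1(v)w-\lambda_1(w)v$, $A,B\in\mathfrak h$, $a,b\in\mathfrak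 r'$, $v,w\in V$, $s\in S'$, take values in $\mathfrak a=V\oplus S'\oplus\mathfrak h\oplus\mathfrak r'$ (the successive summands lying in $V$, $S'$, $\mathfrak h$, $\mathfrak r'$ as appropriate; $[a,v]\in\mathfrak r'$) and define a filtered deformation of $\mathfrak a$: a Lie superalgebra bracket on the superspace $\mathfrak a$, filtered with respect to $\mathfrak a^i=\bigoplus_{j\ge i}\mathfrak a_j$, whose associated graded Lie superalgebra is $\mathfrak a$. -/

import Mathlib

attribute [local instance] LieRing.ofAssociativeRing

open scoped TensorProduct

noncomputable section

/-! ### Lie superalgebras, gradings and filtered deformations -/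

section Super

variable {L : Type*} [AddCommGroup L] [Module ℝ L]

/-- The Koszul sign `(-1)^(p q)`. -/
def koszulSign (p q : ZMod 2) : ℝ := if p = 1 ∧ q = 1 then -1 else 1

/-- The even (`p = 0`) or odd (`p = 1`) part of a `ℤ`-graded space; parity is the degree mod 2. -/
def parityPart (𝒜 : ℤ → Submodule ℝ L) (p : ZMod 2) : Submodule ℝ L :=
  ⨆ (i : ℤ) (_ : (i : ZMod 2) = p), 𝒜 i

/-- The decreasing filtration `L^i = ⨁_{j ≥ i} L_j` of a `ℤ`-graded space. -/
def gradingFiltration (𝒜 : ℤ → Submodule ℝ L) (i : ℤ) : Submodule ℝ L :=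
  ⨆ (j : ℤ) (_ : i ≤ j), 𝒜 j

/-- `b` is a Lie superalgebra bracket for the parity decomposition `P`. -/
structure IsLieSuperbracket (P : ZMod 2 → Submodule ℝ L) (b : L →ₗ[ℝ] L →ₗ[ℝ] L) : Prop where
  internal : DirectSum.IsInternal P
  parity : ∀ p q, ∀ x ∈ P p, ∀ y ∈ P q, b x y ∈ P (p + q)
  skew : ∀ p q, ∀ x ∈ P p, ∀ y ∈ P q, b x y = -(koszulSign p q • b y x)
  jacobi : ∀ p q, ∀ x ∈ P p, ∀ y ∈ P q, ∀ z,
    b x (b y z) = b (b x y) z + koszulSign p q • b y (b x z)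

/-- `b` makes the `ℤ`-graded space `(L, 𝒜)` into a `ℤ`-graded Lie superalgebra. -/
structure IsGradedLieSuperbracket (𝒜 : ℤ → Submodule ℝ L) (b : L →ₗ[ℝ] L →ₗ[ℝ] L) : Prop where
  internal : DirectSum.IsInternal 𝒜
  lie : IsLieSuperbracket (parityPart 𝒜) b
  graded : ∀ i j, ∀ x ∈ 𝒜 i, ∀ y ∈ 𝒜 j, b x y ∈ 𝒜 (i + j)

/-- `b` is a filtered deformation of the `ℤ`-graded Lie superalgebra `(L, 𝒜, b₀)`: it is a Lie
superbracket on the same superspace, it is filtered with respect to `L^i = ⨁_{j ≥ i} L_j`, and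
the bracket it induces on the associated graded space is `b₀`, i.e. it differs from `b₀` by terms
of positive degree (automatically even, as both brackets respect parity). -/
structure IsFilteredDeformation (𝒜 : ℤ → Submodule ℝ L) (b₀ b : L →ₗ[ℝ] L →ₗ[ℝ] L) : Prop where
  base : IsGradedLieSuperbracket 𝒜 b₀
  lie : IsLieSuperbracket (parityPart 𝒜) b
  filtered : ∀ i j, ∀ x ∈ gradingFiltration 𝒜 i, ∀ y ∈ gradingFiltration 𝒜 j,
    b x y ∈ gradingFiltration 𝒜 (i + j)
  assocGraded : ∀ i j, ∀ x ∈ 𝒜 i, ∀ y ∈ 𝒜 j,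
    b x y - b₀ x y ∈ gradingFiltration 𝒜 (i + j + 1)

end Super

/-! ### Spinor modules, Dirac currents, R-symmetry -/

variable {V S : Type*} [AddCommGroup V] [Module ℝ V] [FiniteDimensional ℝ V]
  [AddCommGroup S] [Module ℝ S]

/-- The canonical map `𝔰𝔬(V) → Cl⁰(V)`, `A ↦ ¼ ∑ᵢ (A eᵢ) eⁱ` for a basis `e` with `η`-dual basis
`eⁱ`; for `A ∈ 𝔰𝔬(V)` the image is the element of the spin Lie algebra with `[A, v] = A v`. -/
def spinLift (η : LinearMap.BilinForm ℝ V) (hη : η.Nondegenerate) :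
    Module.End ℝ V →ₗ[ℝ] CliffordAlgebra.even η.toQuadraticMap where
  toFun A := (1 / 4 : ℝ) • ∑ i, (CliffordAlgebra.even.ι η.toQuadraticMap).bilin
    (A (Module.finBasis ℝ V i)) (η.dualBasis hη (Module.finBasis ℝ V) i)
  map_add' A B := by simp [Finset.sum_add_distrib]
  map_smul' c A := by simp [← Finset.smul_sum, smul_comm c]

variable (V S) in
/-- A pseudo-inner product space `(V, η)`, a real (possibly extended) spinor module `S`, that is, a
real module of the even Clifford algebra (finite-dimensional wherever it is used), and a symmetric Dirac current `κ`,
that is, an `𝔰𝔬(V)`-equivariant symmetric bilinear map `S × S → V`. -/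
structure FlatModel where
  η : LinearMap.BilinForm ℝ V
  η_symm : η.IsSymm
  η_nondeg : η.Nondegenerate
  cliff : CliffordAlgebra.even η.toQuadraticMap →ₐ[ℝ] Module.End ℝ S
  κ : S →ₗ[ℝ] S →ₗ[ℝ] V
  κ_symm : ∀ s t, κ s t = κ t s
  κ_equivariant : ∀ A ∈ skewAdjointLieSubalgebra η, ∀ s t,
    A (κ s t) = κ (cliff (spinLift η η_nondeg A) s) t + κ s (cliff (spinLift η η_nondeg A) t)

namespace FlatModel

variable (F : FlatModel V S)

/-- The Lie algebra `𝔰𝔬(V)`. -/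
abbrev so : LieSubalgebra ℝ (Module.End ℝ V) := skewAdjointLieSubalgebra F.η

/-- The spin action `A ↦ (s ↦ A · s)` of `𝔰𝔬(V)` on `S` (extended linearly to all of `End V`, where
it has no meaning and is never used). -/
def spin : Module.End ℝ V →ₗ[ℝ] Module.End ℝ S :=
  F.cliff.toLinearMap ∘ₗ spinLift F.η F.η_nondeg

/-- The R-symmetry algebra `𝔯`. -/
def r : LieSubalgebra ℝ (Module.End ℝ S) where
  carrier := {a | (∀ A ∈ F.so, ∀ s, a (F.spin A s) = F.spin A (a s)) ∧
    ∀ s t, F.κ (a s) t + F.κ s (a t) = 0}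
  add_mem' := by
    rintro a b ⟨ha, ha'⟩ ⟨hb, hb'⟩
    refine ⟨fun A hA s => by simp [ha A hA, hb A hA], fun s t => ?_⟩
    have := congrArg₂ (· + ·) (ha' s t) (hb' s t)
    simp only [add_zero] at this
    rw [← this]
    simp only [LinearMap.add_apply, map_add]
    abel
  zero_mem' := by simp
  smul_mem' := by
    rintro c a ⟨ha, ha'⟩
    refine ⟨fun A hA s => by simp [ha A hA], fun s t => ?_⟩
    simp [← smul_add, ha']
  lie_mem' := by
    rintro a b ⟨ha, ha'⟩ ⟨hb, hb'⟩
    have ka : ∀ s t, F.κ (a s) t = -F.κ s (a t) := fun s t => eq_neg_of_add_eq_zero_left (ha' s t)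
    have kb : ∀ s t, F.κ (b s) t = -F.κ s (b t) := fun s t => eq_neg_of_add_eq_zero_left (hb' s t)
    refine ⟨fun A hA s => ?_, fun s t => ?_⟩
    · simp [LieRing.of_associative_ring_bracket, ha A hA, hb A hA]
    · simp [LieRing.of_associative_ring_bracket, ka, kb]

/-- `(V, η)` has Lorentzian signature (mostly plus: exactly one negative direction). -/
def IsLorentzian : Prop := sigNeg F.η.toQuadraticMap = 1

/-- The Dirac current is causal: for `s ≠ 0` the vector `κ(s,s)` is time-like or null, a null vector
being a non-zero vector `v` with `η(v,v) = 0`. -/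
def IsCausal : Prop := ∀ s, s ≠ 0 →
  F.η (F.κ s s) (F.κ s s) < 0 ∨ (F.κ s s ≠ 0 ∧ F.η (F.κ s s) (F.κ s s) = 0)

/-- The action of `X = (A, a) ∈ 𝔰𝔬(V) ⊕ 𝔯` on `S`. -/
def actS (X : F.so × F.r) : Module.End ℝ S :=
  F.spin (X.1 : Module.End ℝ V) + (X.2 : Module.End ℝ S)

/-- A splitting `⊙²S ≅ V ⊕ ker κ` of `𝔰𝔬(V) ⊕ 𝔯`-modules, given by an equivariant section
`V → ⊙²S` of `κ`; here `⊙²S` is the space of symmetric tensors in `S ⊗ S`. -/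
structure Splitting where
  sec : V →ₗ[ℝ] S ⊗[ℝ] S
  sec_symm : ∀ v, TensorProduct.comm ℝ S S (sec v) = sec v
  κ_sec : ∀ v, TensorProduct.lift F.κ (sec v) = v
  equivariant : ∀ (X : F.so × F.r) (v : V), sec ((X.1 : Module.End ℝ V) v) =
    TensorProduct.map (F.actS X) LinearMap.id (sec v) +
      TensorProduct.map LinearMap.id (F.actS X) (sec v)

/-! ### Graded subalgebras -/

/-- A graded subalgebra `𝔞 = V ⊕ S' ⊕ (𝔥 ⊕ 𝔯')` of `ŝ = V ⊕ S ⊕ (𝔰𝔬(V) ⊕ 𝔯)`. -/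
structure GradedSubalgebra where
  S' : Submodule ℝ S
  h : LieSubalgebra ℝ (Module.End ℝ V)
  r' : LieSubalgebra ℝ (Module.End ℝ S)
  h_le : h ≤ F.so
  r'_le : r' ≤ F.r
  h_act : ∀ A ∈ h, ∀ s ∈ S', F.spin A s ∈ S'
  r'_act : ∀ a ∈ r', ∀ s ∈ S', a s ∈ S'

/-- The whole algebra `ŝ`, as a graded subalgebra of itself. -/
abbrev full : F.GradedSubalgebra where
  S' := ⊤
  h := F.so
  r' := F.r
  h_le := le_rfl
  r'_le := le_rfl
  h_act := fun _ _ _ _ => trivial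
  r'_act := fun _ _ _ _ => trivial

namespace GradedSubalgebra

variable {F} (a b : F.GradedSubalgebra)

/-- `dim S' > ½ dim S`. -/
def IsHighlySupersymmetric : Prop := Module.finrank ℝ S < 2 * Module.finrank ℝ a.S'

/-- `𝔯'` acts faithfully on `S'`. -/
def IsTransitive : Prop := ∀ x ∈ a.r', (∀ s ∈ a.S', x s = 0) → x = 0

/-- The underlying vector space `V ⊕ S' ⊕ 𝔥 ⊕ 𝔯'` of `𝔞`. -/
abbrev Carrier : Type _ := V × a.S' × a.h × a.r'

/-- The inclusion of `V`. -/
def inV : V →ₗ[ℝ] a.Carrier := LinearMap.inl ℝ V (a.S' × a.h × a.r')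

/-- The inclusion of `S'`. -/
def inS : a.S' →ₗ[ℝ] a.Carrier :=
  LinearMap.inr ℝ V (a.S' × a.h × a.r') ∘ₗ LinearMap.inl ℝ a.S' (a.h × a.r')

/-- The inclusion of `𝔥`. -/
def inH : a.h →ₗ[ℝ] a.Carrier :=
  LinearMap.inr ℝ V (a.S' × a.h × a.r') ∘ₗ LinearMap.inr ℝ a.S' (a.h × a.r') ∘ₗ
    LinearMap.inl ℝ a.h a.r'

/-- The inclusion of `𝔯'`. -/
def inR : a.r' →ₗ[ℝ] a.Carrier :=
  LinearMap.inr ℝ V (a.S' × a.h × a.r') ∘ₗ LinearMap.inr ℝ a.S' (a.h × a.r') ∘ₗ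
    LinearMap.inr ℝ a.h a.r'

/-- The four components of an element of `𝔞`, viewed in `V`, `S`, `End V`, `End S`. -/
def comps (x : a.Carrier) : V × S × Module.End ℝ V × Module.End ℝ S :=
  (x.1, x.2.1, x.2.2.1, x.2.2.2)

/-- The grading: `V`, `S'`, `𝔥 ⊕ 𝔯'` in degrees `-2`, `-1`, `0`. -/
def grading (i : ℤ) : Submodule ℝ a.Carrier :=
  if i = -2 then LinearMap.range a.inV
  else if i = -1 then LinearMap.range a.inS
  else if i = 0 then LinearMap.range a.inH ⊔ LinearMap.range a.inR
  else ⊥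

/-- The bracket of `𝔞`, which is the restriction of the bracket of `ŝ`. -/
def bracket : a.Carrier →ₗ[ℝ] a.Carrier →ₗ[ℝ] a.Carrier :=
  LinearMap.mk₂ ℝ (fun x y =>
    ((x.2.2.1 : Module.End ℝ V) y.1 - (y.2.2.1 : Module.End ℝ V) x.1 + F.κ x.2.1 y.2.1,
      ⟨F.spin x.2.2.1 y.2.1 + (x.2.2.2 : Module.End ℝ S) y.2.1
          - F.spin y.2.2.1 x.2.1 - (y.2.2.2 : Module.End ℝ S) x.2.1,
        a.S'.sub_mem (a.S'.sub_mem (a.S'.add_mem (a.h_act _ x.2.2.1.2 _ y.2.1.2)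
          (a.r'_act _ x.2.2.2.2 _ y.2.1.2)) (a.h_act _ y.2.2.1.2 _ x.2.1.2))
          (a.r'_act _ y.2.2.2.2 _ x.2.1.2)⟩,
      ⁅x.2.2.1, y.2.2.1⁆, ⁅x.2.2.2, y.2.2.2⁆))
    (fun x x' y => by
      ext <;> simp <;> abel)
    (fun c x y => by
      ext <;> simp [smul_sub, smul_add])
    (fun x y y' => by
      ext <;> simp <;> abel)
    (fun c x y => by
      ext <;> simp [smul_sub, smul_add])

/-! ### The degree-2 Spencer complex

For graded subalgebras `a`, `b` with `S'_a ⊆ S'_b`, this is the complex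
`C^{2,•}(𝔞_-; 𝔟)` of degree-2 cochains of `𝔞_- = V ⊕ S'_a` with values in the `𝔞_-`-module `𝔟`. -/

/-- `C^{2,1}(𝔞_-; 𝔟) = Hom(V, 𝔥_b) ⊕ Hom(V, 𝔯'_b)`. -/
abbrev C21 : Type _ := (V →ₗ[ℝ] b.h) × (V →ₗ[ℝ] b.r')

/-- Quadruples `(α, β, γ, ρ)` of bilinear maps `V × V → V`, `V × S'_a → S'_b`,
`S'_a × S'_a → 𝔥_b`, `S'_a × S'_a → 𝔯'_b`. -/
@[ext]
structure Bil22 where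
  α : V →ₗ[ℝ] V →ₗ[ℝ] V
  β : V →ₗ[ℝ] a.S' →ₗ[ℝ] b.S'
  γ : a.S' →ₗ[ℝ] a.S' →ₗ[ℝ] b.h
  ρ : a.S' →ₗ[ℝ] a.S' →ₗ[ℝ] b.r'

namespace Bil22

variable {a b}

instance : Zero (Bil22 a b) := ⟨⟨0, 0, 0, 0⟩⟩
instance : Add (Bil22 a b) := ⟨fun c d => ⟨c.α + d.α, c.β + d.β, c.γ + d.γ, c.ρ + d.ρ⟩⟩
instance : Neg (Bil22 a b) := ⟨fun c => ⟨-c.α, -c.β, -c.γ, -c.ρ⟩⟩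
instance : SMul ℝ (Bil22 a b) := ⟨fun k c => ⟨k • c.α, k • c.β, k • c.γ, k • c.ρ⟩⟩

@[simp] theorem zero_α : (0 : Bil22 a b).α = 0 := rfl
@[simp] theorem zero_β : (0 : Bil22 a b).β = 0 := rfl
@[simp] theorem zero_γ : (0 : Bil22 a b).γ = 0 := rfl
@[simp] theorem zero_ρ : (0 : Bil22 a b).ρ = 0 := rfl
@[simp] theorem add_α (c d : Bil22 a b) : (c + d).α = c.α + d.α := rfl
@[simp] theorem add_β (c d : Bil22 a b) : (c + d).β = c.β + d.β := rfl
@[simp] theorem add_γ (c d : Bil22 a b) : (c + d).γ = c.γ + d.γ := rfl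
@[simp] theorem add_ρ (c d : Bil22 a b) : (c + d).ρ = c.ρ + d.ρ := rfl
@[simp] theorem neg_α (c : Bil22 a b) : (-c).α = -c.α := rfl
@[simp] theorem smul_α (k : ℝ) (c : Bil22 a b) : (k • c).α = k • c.α := rfl
@[simp] theorem neg_β (c : Bil22 a b) : (-c).β = -c.β := rfl
@[simp] theorem smul_β (k : ℝ) (c : Bil22 a b) : (k • c).β = k • c.β := rfl
@[simp] theorem neg_γ (c : Bil22 a b) : (-c).γ = -c.γ := rfl
@[simp] theorem smul_γ (k : ℝ) (c : Bil22 a b) : (k • c).γ = k • c.γ := rfl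
@[simp] theorem neg_ρ (c : Bil22 a b) : (-c).ρ = -c.ρ := rfl
@[simp] theorem smul_ρ (k : ℝ) (c : Bil22 a b) : (k • c).ρ = k • c.ρ := rfl

instance : AddCommGroup (Bil22 a b) where
  add_assoc c d e := by ext <;> simp [add_assoc]
  zero_add c := by ext <;> simp
  add_zero c := by ext <;> simp
  add_comm c d := by ext <;> simp [add_comm]
  neg_add_cancel c := by ext <;> simp
  nsmul := nsmulRec
  zsmul := zsmulRec

instance : Module ℝ (Bil22 a b) where
  one_smul c := by ext <;> simp
  mul_smul k l c := by ext <;> simp [mul_smul]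
  smul_zero k := by ext <;> simp
  smul_add k c d := by ext <;> simp
  add_smul k l c := by ext <;> simp [add_smul]
  zero_smul c := by ext <;> simp

end Bil22

/-- `C^{2,2}(𝔞_-; 𝔟)`: `α` is alternating, `γ` and `ρ` are symmetric. -/
def C22 : Submodule ℝ (Bil22 a b) where
  carrier := {c | (∀ v, c.α v v = 0) ∧ (∀ s t, c.γ s t = c.γ t s) ∧ ∀ s t, c.ρ s t = c.ρ t s}
  add_mem' := by
    rintro c d ⟨h1, h2, h3⟩ ⟨k1, k2, k3⟩
    exact ⟨fun v => by simp [h1, k1], fun s t => by simp [h2 s t, k2 s t],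
      fun s t => by simp [h3 s t, k3 s t]⟩
  zero_mem' := by simp
  smul_mem' := by
    rintro r c ⟨h1, h2, h3⟩
    exact ⟨fun v => by simp [h1], fun s t => by simp [h2 s t], fun s t => by simp [h3 s t]⟩

/-- The cocycles `Z^{2,2}(𝔞_-; 𝔟)`, the kernel of the differential to
`C^{2,3} = Hom(V ⊗ ⊙²S'_a, V) ⊕ Hom(⊙³S'_a, S'_b)` (whose elements are determined by their
polarised values at `(v, s, s)` and `(s, s, s)`). -/
def Z22 : Submodule ℝ (Bil22 a b) where
  carrier := {c | c ∈ C22 a b ∧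
    (∀ (v : V) (s : a.S'), c.α (F.κ s s) v + (2 : ℝ) • F.κ s (c.β v s)
      + (c.γ s s : Module.End ℝ V) v = 0) ∧
    ∀ s : a.S', (c.β (F.κ s s) s : S) + F.spin (c.γ s s) s
      + (c.ρ s s : Module.End ℝ S) s = 0}
  add_mem' := by
    rintro c d ⟨h1, h2, h3⟩ ⟨k1, k2, k3⟩
    refine ⟨add_mem h1 k1, fun v s => ?_, fun s => ?_⟩
    · have := congrArg₂ (· + ·) (h2 v s) (k2 v s)
      simp only [add_zero] at this
      rw [← this]
      simp
      abel
    · have := congrArg₂ (· + ·) (h3 s) (k3 s)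
      simp only [add_zero] at this
      rw [← this]
      simp
      abel
  zero_mem' := ⟨zero_mem _, by simp, by simp⟩
  smul_mem' := by
    rintro r c ⟨h1, h2, h3⟩
    refine ⟨Submodule.smul_mem _ _ h1, fun v s => ?_, fun s => ?_⟩
    · have := congrArg (r • ·) (h2 v s)
      simp only [smul_zero] at this
      rw [← this]
      simp [smul_add, smul_comm r (2 : ℝ)]
    · have := congrArg (r • ·) (h3 s)
      simp only [smul_zero] at this
      rw [← this]
      simp [smul_add]

variable {a b} in
/-- The differential `C^{2,1}(𝔞_-; 𝔟) → C^{2,2}(𝔞_-; 𝔟)`, `λ = (λ₁, λ₂) ↦ (α, β, γ, ρ)` with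
`α(v,w) = λ₁(v)w - λ₁(w)v`, `β(v,s) = λ₁(v)·s + λ₂(v)s`, `γ = -λ₁ ∘ κ`, `ρ = -λ₂ ∘ κ`. -/
def d21 (hab : a.S' ≤ b.S') : C21 b →ₗ[ℝ] Bil22 a b where
  toFun l :=
    { α := LinearMap.mk₂ ℝ (fun v w => (l.1 v : Module.End ℝ V) w - (l.1 w : Module.End ℝ V) v)
        (fun v v' w => by simp; abel) (fun c v w => by simp [smul_sub])
        (fun v w w' => by simp; abel) (fun c v w => by simp [smul_sub])
      β := LinearMap.mk₂ ℝ (fun v s => ⟨F.spin (l.1 v) s + (l.2 v : Module.End ℝ S) s,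
          b.S'.add_mem (b.h_act _ (l.1 v).2 _ (hab s.2)) (b.r'_act _ (l.2 v).2 _ (hab s.2))⟩)
        (fun v v' s => by ext; simp; abel) (fun c v s => by ext; simp [smul_add])
        (fun v s s' => by ext; simp; abel) (fun c v s => by ext; simp [smul_add])
      γ := -((F.κ.compl₁₂ a.S'.subtype a.S'.subtype).compr₂ l.1)
      ρ := -((F.κ.compl₁₂ a.S'.subtype a.S'.subtype).compr₂ l.2) }
  map_add' l m := by
    ext <;> simp <;> abel
  map_smul' c l := by
    ext <;> simp [smul_sub, smul_add]

variable {a b} in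
theorem d21_mem_Z22 (hab : a.S' ≤ b.S') (l : C21 b) : d21 hab l ∈ Z22 a b := by
  refine ⟨⟨fun v => by simp [d21], fun s t => ?_, fun s t => ?_⟩, fun v s => ?_, fun s => ?_⟩
  · simp [d21, F.κ_symm s t]
  · simp [d21, F.κ_symm s t]
  · have h1 := F.κ_equivariant _ (b.h_le (l.1 v).2) s s
    have h2 := (b.r'_le (l.2 v).2).2 (s : S) s
    rw [F.κ_symm _ (s : S), ← two_smul ℝ] at h2
    rw [F.κ_symm (F.cliff _ _) (s : S), ← two_smul ℝ] at h1
    simp only [d21, LinearMap.coe_mk, AddHom.coe_mk, LinearMap.mk₂_apply, map_add, smul_add, h2,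
      LinearMap.neg_apply, LinearMap.compr₂_apply, LinearMap.compl₁₂_apply,
      Submodule.subtype_apply, NegMemClass.coe_neg, h1]
    simp [spin]
  · simp [d21]

variable {a b} in
/-- The coboundaries `B^{2,2}(𝔞_-; 𝔟)`. -/
def B22 (hab : a.S' ≤ b.S') : Submodule ℝ (Bil22 a b) := LinearMap.range (d21 hab)

variable {a b} in
/-- The Spencer cohomology group `H^{2,2}(𝔞_-; 𝔟) = Z^{2,2} / B^{2,2}`. -/
abbrev H22 (hab : a.S' ≤ b.S') : Type _ := Z22 a b ⧸ (B22 hab).submoduleOf (Z22 a b)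

variable {a b} in
/-- The cohomology class of a cocycle. -/
def cls (hab : a.S' ≤ b.S') : Z22 a b →ₗ[ℝ] H22 hab := Submodule.mkQ _

/-- The map `i_*` on cochains, composition with the inclusion `𝔞 → ŝ`. -/
def pushBil : Bil22 a a →ₗ[ℝ] Bil22 a F.full where
  toFun c :=
    { α := c.α
      β := c.β.compr₂ (Submodule.inclusion le_top)
      γ := c.γ.compr₂ (LieSubalgebra.inclusion a.h_le : a.h →ₗ[ℝ] F.so)
      ρ := c.ρ.compr₂ (LieSubalgebra.inclusion a.r'_le : a.r' →ₗ[ℝ] F.r) }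
  map_add' c d := by ext <;> simp
  map_smul' r c := by ext <;> simp

theorem pushBil_mem_Z22 (c : Bil22 a a) (hc : c ∈ Z22 a a) : a.pushBil c ∈ Z22 a F.full := by
  obtain ⟨⟨h1, h2, h3⟩, h4, h5⟩ := hc
  refine ⟨⟨h1, fun s t => ?_, fun s t => ?_⟩, h4, h5⟩
  · simp [pushBil, h2 s t]
  · simp [pushBil, h3 s t]

/-- The map `i_*` on cocycles. -/
def pushZ : Z22 a a →ₗ[ℝ] Z22 a F.full := a.pushBil.restrict a.pushBil_mem_Z22

/-- The map `i_* : H^{2,2}(𝔞_-; 𝔞) → H^{2,2}(𝔞_-; ŝ)`. -/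
def pushH : H22 (le_refl a.S') →ₗ[ℝ] H22 (a := a) (b := F.full) le_top :=
  Submodule.mapQ _ _ a.pushZ (by
    rintro ⟨c, hc⟩ ⟨l, hl⟩
    refine ⟨((LieSubalgebra.inclusion a.h_le : a.h →ₗ[ℝ] F.so) ∘ₗ l.1,
      (LieSubalgebra.inclusion a.r'_le : a.r' →ₗ[ℝ] F.r) ∘ₗ l.2), ?_⟩
    simp only [Submodule.coe_subtype] at hl
    subst hl
    rfl)

end GradedSubalgebra

/-! ### Normalised cocycles -/

variable {F}

/-- The space `Ĥ^{2,2}` of normalised cocycles `β + γ + ρ ∈ Z^{2,2}(ŝ_-; ŝ)`: there is no component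
in `Hom(∧²V, V)`, and `ρ` vanishes on the copy of `V` in `⊙²S` given by the splitting. -/
structure NormalisedCocycle (sp : F.Splitting) where
  β : V →ₗ[ℝ] S →ₗ[ℝ] S
  γ : S →ₗ[ℝ] S →ₗ[ℝ] F.so
  ρ : S →ₗ[ℝ] S →ₗ[ℝ] F.r
  γ_symm : ∀ s t, γ s t = γ t s
  ρ_symm : ∀ s t, ρ s t = ρ t s
  cocycle₁ : ∀ v s, (2 : ℝ) • F.κ s (β v s) + (γ s s : Module.End ℝ V) v = 0
  cocycle₂ : ∀ s, β (F.κ s s) s + F.spin (γ s s) s + (ρ s s : Module.End ℝ S) s = 0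
  normalised : ∀ v, TensorProduct.lift ρ (sp.sec v) = 0

namespace NormalisedCocycle

variable {sp : F.Splitting} (c : NormalisedCocycle sp)

/-- `(X · β)(v, -)` for `X = (A, a) ∈ 𝔰𝔬(V) ⊕ 𝔯`. -/
def actβ (X : F.so × F.r) (v : V) : S →ₗ[ℝ] S :=
  F.actS X ∘ₗ c.β v - c.β ((X.1 : Module.End ℝ V) v) - c.β v ∘ₗ F.actS X

/-- `X · γ` for `X = (A, a) ∈ 𝔰𝔬(V) ⊕ 𝔯`. -/
def actγ (X : F.so × F.r) : S →ₗ[ℝ] S →ₗ[ℝ] F.so :=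
  c.γ.compr₂ (LieAlgebra.ad ℝ F.so X.1) - c.γ.compl₁₂ (F.actS X) LinearMap.id
    - c.γ.compl₁₂ LinearMap.id (F.actS X)

/-- `X · ρ` for `X = (A, a) ∈ 𝔰𝔬(V) ⊕ 𝔯`. -/
def actρ (X : F.so × F.r) : S →ₗ[ℝ] S →ₗ[ℝ] F.r :=
  c.ρ.compr₂ (LieAlgebra.ad ℝ F.r X.2) - c.ρ.compl₁₂ (F.actS X) LinearMap.id
    - c.ρ.compl₁₂ LinearMap.id (F.actS X)

/-- Invariance under `𝔞₀ = 𝔥 ⊕ 𝔯'`. -/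
def IsInvariant (a : F.GradedSubalgebra) : Prop :=
  ∀ X : F.so × F.r, (X.1 : Module.End ℝ V) ∈ a.h → (X.2 : Module.End ℝ S) ∈ a.r' →
    (∀ v, c.actβ X v = 0) ∧ c.actγ X = 0 ∧ c.actρ X = 0

/-- The cocycle `i^* c ∈ Z^{2,2}(𝔞_-; ŝ)`, the restriction of `c` to `𝔞_-`. -/
def pull (a : F.GradedSubalgebra) : GradedSubalgebra.Z22 a F.full :=
  ⟨{ α := 0
     β := (c.β.compl₂ a.S'.subtype).compr₂ (Submodule.topEquiv (R := ℝ) (M := S)).symm.toLinearMap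
     γ := c.γ.compl₁₂ a.S'.subtype a.S'.subtype
     ρ := c.ρ.compl₁₂ a.S'.subtype a.S'.subtype },
    ⟨⟨fun v => by simp, fun s t => by simp [c.γ_symm (s : S) t],
      fun s t => by simp [c.ρ_symm (s : S) t]⟩,
      fun v s => by simpa using c.cocycle₁ v (s : S), fun s => by simpa using c.cocycle₂ (s : S)⟩⟩

/-- `Θ₁(v, -, -)`, with `Θ₁(v,s,s) = 2 γ(s, β(v,s)) - (λ₁(v)·γ)(s,s) - (λ₂(v)·γ)(s,s)`. -/
def Θ₁ (l₁ : V →ₗ[ℝ] F.so) (l₂ : V →ₗ[ℝ] F.r) (v : V) : S →ₗ[ℝ] S →ₗ[ℝ] F.so :=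
  c.γ.compl₁₂ LinearMap.id (c.β v) + c.γ.compl₁₂ (c.β v) LinearMap.id - c.actγ (l₁ v, l₂ v)

/-- `Θ₂(v, -, -)`, with `Θ₂(v,s,s) = 2 ρ(s, β(v,s)) - (λ₁(v)·ρ)(s,s) - (λ₂(v)·ρ)(s,s)`. -/
def Θ₂ (l₁ : V →ₗ[ℝ] F.so) (l₂ : V →ₗ[ℝ] F.r) (v : V) : S →ₗ[ℝ] S →ₗ[ℝ] F.r :=
  c.ρ.compl₁₂ LinearMap.id (c.β v) + c.ρ.compl₁₂ (c.β v) LinearMap.id - c.actρ (l₁ v, l₂ v)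

/-- The equations `θ₁(v, κ(s,s)) = Θ₁(v,s,s)` and `θ₂(v, κ(s,s)) = Θ₂(v,s,s)` for `s ∈ S'`. -/
def DefinesTheta (a : F.GradedSubalgebra) (l₁ : V →ₗ[ℝ] F.so) (l₂ : V →ₗ[ℝ] F.r)
    (θ₁ : V →ₗ[ℝ] V →ₗ[ℝ] F.so) (θ₂ : V →ₗ[ℝ] V →ₗ[ℝ] F.r) : Prop :=
  ∀ v, ∀ s ∈ a.S', θ₁ v (F.κ s s) = c.Θ₁ l₁ l₂ v s s ∧ θ₂ v (F.κ s s) = c.Θ₂ l₁ l₂ v s s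

/-- The action of `θ₁(v,w) + θ₂(v,w)` on `S'` is that of the `λ`-twisted curvature of `β`. -/
def CurvatureEq (a : F.GradedSubalgebra) (l₁ : V →ₗ[ℝ] F.so) (l₂ : V →ₗ[ℝ] F.r)
    (θ₁ : V →ₗ[ℝ] V →ₗ[ℝ] F.so) (θ₂ : V →ₗ[ℝ] V →ₗ[ℝ] F.r) : Prop :=
  ∀ v w, ∀ s ∈ a.S', F.spin (θ₁ v w) s + (θ₂ v w : Module.End ℝ S) s =
    c.β v (c.β w s) - c.β w (c.β v s)
      + c.actβ (l₁ v, l₂ v) w s - c.actβ (l₁ w, l₂ w) v s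

end NormalisedCocycle

namespace GradedSubalgebra

variable (a : F.GradedSubalgebra)

/-- The Dirac kernel `𝔇`, the kernel of `κ` on the symmetric tensors `⊙²S' ⊆ S' ⊗ S'`. -/
def diracKernel : Submodule ℝ (a.S' ⊗[ℝ] a.S') :=
  LinearMap.ker ((TensorProduct.comm ℝ a.S' a.S').toLinearMap - LinearMap.id) ⊓
    LinearMap.ker (TensorProduct.lift (F.κ.compl₁₂ a.S'.subtype a.S'.subtype))

/-- A class in `H^{2,2}(𝔞_-; 𝔞)` is admissible if its image in `H^{2,2}(𝔞_-; ŝ)` is that of an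
`𝔞₀`-invariant normalised cocycle of `ŝ`. -/
def IsAdmissible (sp : F.Splitting) (x : H22 (le_refl a.S')) : Prop :=
  ∃ c : NormalisedCocycle sp, c.IsInvariant a ∧ a.pushH x = cls _ (c.pull a)

/-- `c` is an `𝔞₀`-invariant normalised cocycle and `λ = λ₁ + λ₂ : V → 𝔰𝔬(V) ⊕ 𝔯` is a map with
`i_* μ = i^* c + ∂λ`. -/
structure IsPresentation {sp : F.Splitting} (μ : Z22 a a) (c : NormalisedCocycle sp)
    (l₁ : V →ₗ[ℝ] F.so) (l₂ : V →ₗ[ℝ] F.r) : Prop where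
  invariant : c.IsInvariant a
  eq : a.pushBil μ = (c.pull a : Bil22 a F.full) +
    d21 (a := a) (b := F.full) le_top (l₁, l₂)

/-- An admissible class is integrable if `Θ₁` and `Θ₂` annihilate the Dirac kernel and the maps
`θ₁`, `θ₂` through which they factor satisfy `CurvatureEq`. -/
def IsIntegrable (sp : F.Splitting) (x : H22 (le_refl a.S')) : Prop :=
  ∃ (μ : Z22 a a) (c : NormalisedCocycle sp) (l₁ : V →ₗ[ℝ] F.so) (l₂ : V →ₗ[ℝ] F.r),
    cls _ μ = x ∧ a.IsPresentation μ c l₁ l₂ ∧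
    (∀ v, ∀ d ∈ a.diracKernel,
      TensorProduct.lift ((c.Θ₁ l₁ l₂ v).compl₁₂ a.S'.subtype a.S'.subtype) d = 0 ∧
      TensorProduct.lift ((c.Θ₂ l₁ l₂ v).compl₁₂ a.S'.subtype a.S'.subtype) d = 0) ∧
    ∃ θ₁ θ₂, c.DefinesTheta a l₁ l₂ θ₁ θ₂ ∧ c.CurvatureEq a l₁ l₂ θ₁ θ₂

/-- The explicit brackets on `𝔞` built from `c`, `λ`, `θ₁`, `θ₂`; those in the opposite order are
fixed by super-skew-symmetry. That the right-hand sides are components of elements of `𝔞` is part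
of the claim. -/
structure IsExplicitBracket {sp : F.Splitting} (c : NormalisedCocycle sp)
    (l₁ : V →ₗ[ℝ] F.so) (l₂ : V →ₗ[ℝ] F.r)
    (θ₁ : V →ₗ[ℝ] V →ₗ[ℝ] F.so) (θ₂ : V →ₗ[ℝ] V →ₗ[ℝ] F.r)
    (b : a.Carrier →ₗ[ℝ] a.Carrier →ₗ[ℝ] a.Carrier) : Prop where
  hh : ∀ A B : a.h, a.comps (b (a.inH A) (a.inH B)) =
    (0, 0, (A : Module.End ℝ V) * B - B * A, 0)
  rr : ∀ x y : a.r', a.comps (b (a.inR x) (a.inR y)) =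
    (0, 0, 0, (x : Module.End ℝ S) * y - y * x)
  hr : ∀ (A : a.h) (x : a.r'), a.comps (b (a.inH A) (a.inR x)) = (0, 0, 0, 0)
  hv : ∀ (A : a.h) (v : V), a.comps (b (a.inH A) (a.inV v)) =
    ((A : Module.End ℝ V) v, 0,
      ⁅(A : Module.End ℝ V), (l₁ v : Module.End ℝ V)⁆ - l₁ ((A : Module.End ℝ V) v),
      -(l₂ ((A : Module.End ℝ V) v) : Module.End ℝ S))
  rv : ∀ (x : a.r') (v : V), a.comps (b (a.inR x) (a.inV v)) =
    (0, 0, 0, ⁅(x : Module.End ℝ S), (l₂ v : Module.End ℝ S)⁆)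
  hs : ∀ (A : a.h) (s : a.S'), a.comps (b (a.inH A) (a.inS s)) = (0, F.spin A s, 0, 0)
  rs : ∀ (x : a.r') (s : a.S'), a.comps (b (a.inR x) (a.inS s)) =
    (0, (x : Module.End ℝ S) s, 0, 0)
  ss : ∀ s t : a.S', a.comps (b (a.inS s) (a.inS t)) =
    (F.κ s t, 0, (c.γ s t : Module.End ℝ V) - l₁ (F.κ s t),
      (c.ρ s t : Module.End ℝ S) - l₂ (F.κ s t))
  vs : ∀ (v : V) (s : a.S'), a.comps (b (a.inV v) (a.inS s)) =
    (0, c.β v s + F.spin (l₁ v) s + (l₂ v : Module.End ℝ S) s, 0, 0)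
  vv : ∀ v w : V, a.comps (b (a.inV v) (a.inV w)) =
    ((l₁ v : Module.End ℝ V) w - (l₁ w : Module.End ℝ V) v, 0,
      (θ₁ v w : Module.End ℝ V)
        - l₁ ((l₁ v : Module.End ℝ V) w - (l₁ w : Module.End ℝ V) v)
        + ⁅(l₁ v : Module.End ℝ V), (l₁ w : Module.End ℝ V)⁆,
      (θ₂ v w : Module.End ℝ S)
        - l₂ ((l₁ v : Module.End ℝ V) w - (l₁ w : Module.End ℝ V) v)
        + ⁅(l₂ v : Module.End ℝ S), (l₂ w : Module.End ℝ S)⁆)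

end GradedSubalgebra

end FlatModel

end

/-!
The brackets are those of a filtered deformation `[-,-] = [-,-]₀ + [-,-]₂ + [-,-]₄` of `𝔞`, written
in terms of `𝔞₀ = 𝔥 ⊕ 𝔯'` acting on `V` and `S'`. The degree-2 part consists of the `𝔞`-valued cocycle
`μ = α + β + γ + ρ` and of `τ X = X · λ : V → 𝔞₀` for `X ∈ 𝔞₀`; the degree-4 part is
`δ = θ - λ ∘ α + [λ, λ]`. Since `i_* μ - ∂λ` is the restriction of an `𝔞₀`-invariant cocycle,
`X · i_* μ = ∂(τ X)`, which is all that the argument retains of the ambient cocycle on `ŝ_-`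
(`IsPresentation.cocycle`). In these terms `Θ` and the curvature equation become the Jacobi
identities for `V, S, S` and `V, V, S`: `δ(v, κ_s) = 2 γ(s, β_v s) + τ_{γ(s,s)} v` and
`δ(v, w) s = [β_v, β_w] s - β_{α(v,w)} s` (`IsPresentation.IsTwist.definesTheta_iff`,
`IsPresentation.IsTwist.isCurvature`).

Local homogeneity, that is, the fact that the vectors `κ(s,s)` with `s ∈ S'` span `V`
(`IsCausal.span_κ_eq_top`), is used throughout. It gives the uniqueness of `θ`, it shows that `τ`
and `δ` take values in `𝔞₀`, and it makes `𝔞₀` act faithfully on `S'`, so that `δ`, whose action on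
`S'` is alternating, is alternating itself. A space-like `v` orthogonal to `κ(S', S')` is excluded
as follows: `S'` is isotropic for `η(v, κ(-,-))`, so that this form is degenerate, whereas the
square of the spin action of the boost `v ∧ w`, `w` time-like and orthogonal to `v`, is a positive
scalar, which contradicts causality of `κ`. Time-like vectors are excluded directly, and null ones
by reduction to the space-like case.

Integrability is a condition on one presentation of the cohomology class. Another presentation
changes `μ` by `∂ν` with `ν : V → 𝔞₀`, which corresponds to replacing the complement `V` of
`S' ⊕ 𝔞₀` by the graph of `ν`; rewriting `δ` accordingly gives the curvature for the new presentation
(`IsShift.exists_isCurvature`).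

The Jacobi identities for three even elements follow from the others and the one in `𝔞₀`: for even `x`,
`y` the operator `[ad x, ad y] - ad [x, y]` is a derivation that kills odd elements, hence kills
`[s, s] = κ_s + γ(s,s) + ρ(s,s)`; by local homogeneity these elements together with `𝔞₀` span the
even part (`IsLieSuperbracket.of_generated`).
-/

noncomputable section

/-! ### The spin representation -/

section Clifford

open CliffordAlgebra

theorem skew_apply {V : Type*} [AddCommGroup V] [Module ℝ V] {η : LinearMap.BilinForm ℝ V}
    {A : Module.End ℝ V} (hA : A ∈ skewAdjointLieSubalgebra η) (x y : V) :
    η (A x) y = -η x (A y) := by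
  simpa using hA x y

theorem ι_mul_ι_swap {V : Type*} [AddCommGroup V] [Module ℝ V] {η : LinearMap.BilinForm ℝ V}
    (hs : η.IsSymm) (v w : V) :
    ι η.toQuadraticMap w * ι η.toQuadraticMap v =
      algebraMap ℝ _ (2 * η v w) - ι η.toQuadraticMap v * ι η.toQuadraticMap w := by
  have := ι_mul_ι_add_swap (Q := η.toQuadraticMap) w v
  rw [eq_sub_iff_add_eq, this, LinearMap.BilinMap.polar_toQuadraticMap, hs.eq w v, two_mul]

/-- The endomorphism `v ∧ w` of `V`, given by `x ↦ η(w, x) v - η(v, x) w`. -/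
def wedgeEnd {V : Type*} [AddCommGroup V] [Module ℝ V] (η : LinearMap.BilinForm ℝ V) (v w : V) :
    Module.End ℝ V :=
  (η w).smulRight v - (η v).smulRight w

@[simp]
theorem wedgeEnd_apply {V : Type*} [AddCommGroup V] [Module ℝ V] (η : LinearMap.BilinForm ℝ V)
    (v w x : V) : wedgeEnd η v w x = η w x • v - η v x • w := rfl

theorem wedgeEnd_mem {V : Type*} [AddCommGroup V] [Module ℝ V] {η : LinearMap.BilinForm ℝ V}
    (hs : η.IsSymm) (v w : V) : wedgeEnd η v w ∈ skewAdjointLieSubalgebra η := by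
  intro x y
  simp [hs.eq x v, hs.eq x w, mul_comm]

variable {V : Type*} [AddCommGroup V] [Module ℝ V] [FiniteDimensional ℝ V]
  {η : LinearMap.BilinForm ℝ V}

theorem sum_dualBasis_left (hη : η.Nondegenerate) (x : V) :
    ∑ i, η x (Module.finBasis ℝ V i) • η.dualBasis hη (Module.finBasis ℝ V) i = x := by
  conv_rhs => rw [← (η.dualBasis hη (Module.finBasis ℝ V)).sum_repr x]
  exact Finset.sum_congr rfl fun j _ => by rw [LinearMap.BilinForm.dualBasis_repr_apply]

theorem sum_dualBasis_right (hη : η.Nondegenerate) (x : V) :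
    ∑ i, η (η.dualBasis hη (Module.finBasis ℝ V) i) x • Module.finBasis ℝ V i = x := by
  conv_rhs => rw [← (Module.finBasis ℝ V).sum_repr x]
  refine Finset.sum_congr rfl fun j _ => ?_
  congr 1
  conv_lhs => rw [← (Module.finBasis ℝ V).sum_repr x]
  simp [LinearMap.BilinForm.apply_dualBasis_left, -Module.Basis.sum_repr]

/-- The canonical tensor `∑ eᵢ ⊗ eⁱ` is annihilated by every skew-adjoint endomorphism. -/
theorem sum_dualBasis_skew {W : Type*} [AddCommGroup W] [Module ℝ W] (hη : η.Nondegenerate)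
    {A : Module.End ℝ V} (hA : A ∈ skewAdjointLieSubalgebra η) (f : V →ₗ[ℝ] V →ₗ[ℝ] W) :
    ∑ i, f (Module.finBasis ℝ V i) (A (η.dualBasis hη (Module.finBasis ℝ V) i)) =
      -∑ i, f (A (Module.finBasis ℝ V i)) (η.dualBasis hη (Module.finBasis ℝ V) i) := by
  have h1 := fun i => sum_dualBasis_left hη (A (η.dualBasis hη (Module.finBasis ℝ V) i))
  have h2 := fun i => sum_dualBasis_right hη (A (Module.finBasis ℝ V i))
  calc _ = ∑ i, ∑ j, η (A (η.dualBasis hη (Module.finBasis ℝ V) i)) (Module.finBasis ℝ V j) •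
        f (Module.finBasis ℝ V i) (η.dualBasis hη (Module.finBasis ℝ V) j) :=
        Finset.sum_congr rfl fun i _ => by conv_lhs => rw [← h1 i, map_sum]; simp only [map_smul]
    _ = ∑ j, ∑ i, η (A (η.dualBasis hη (Module.finBasis ℝ V) i)) (Module.finBasis ℝ V j) •
        f (Module.finBasis ℝ V i) (η.dualBasis hη (Module.finBasis ℝ V) j) := Finset.sum_comm
    _ = -∑ j, f (A (Module.finBasis ℝ V j)) (η.dualBasis hη (Module.finBasis ℝ V) j) := by
      rw [← Finset.sum_neg_distrib]
      refine Finset.sum_congr rfl fun j _ => ?_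
      conv_rhs => rw [← h2 j, map_sum, LinearMap.sum_apply, ← Finset.sum_neg_distrib]
      exact Finset.sum_congr rfl fun i _ => by rw [skew_apply hA]; simp

theorem coe_spinLift (hη : η.Nondegenerate) (A : Module.End ℝ V) :
    (spinLift η hη A : CliffordAlgebra η.toQuadraticMap) = (1 / 4 : ℝ) •
      ∑ i, ι η.toQuadraticMap (A (Module.finBasis ℝ V i)) *
        ι η.toQuadraticMap (η.dualBasis hη (Module.finBasis ℝ V) i) := by
  simp [spinLift]
  rfl

/-- The element of the spin Lie algebra attached to `A` acts on vectors by commutators as `A`. -/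
theorem spinLift_mul_ι_sub (hs : η.IsSymm) (hη : η.Nondegenerate) {A : Module.End ℝ V}
    (hA : A ∈ skewAdjointLieSubalgebra η) (v : V) :
    (spinLift η hη A : CliffordAlgebra η.toQuadraticMap) * ι η.toQuadraticMap v -
      ι η.toQuadraticMap v * spinLift η hη A = ι η.toQuadraticMap (A v) := by
  have key : ∀ x y : V, ι η.toQuadraticMap x * ι η.toQuadraticMap y * ι η.toQuadraticMap v -
      ι η.toQuadraticMap v * (ι η.toQuadraticMap x * ι η.toQuadraticMap y) =
      (2 * η v y) • ι η.toQuadraticMap x - (2 * η v x) • ι η.toQuadraticMap y := fun x y => by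
    rw [mul_assoc, ι_mul_ι_swap hs v y, mul_sub, ← mul_assoc, ι_mul_ι_swap hs v x, sub_mul,
      ← Algebra.commutes, ← Algebra.smul_def, ← Algebra.smul_def, mul_assoc]
    abel
  have h1 := congrArg A (sum_dualBasis_right hη v)
  have h2 := sum_dualBasis_left hη (A v)
  rw [map_sum] at h1
  simp only [map_smul] at h1
  rw [coe_spinLift, smul_mul_assoc, mul_smul_comm, ← smul_sub, Finset.sum_mul, Finset.mul_sum,
    ← Finset.sum_sub_distrib]
  simp only [key]
  rw [Finset.sum_sub_distrib]
  have e1 : ∑ i, (2 * η v (η.dualBasis hη (Module.finBasis ℝ V) i)) •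
      ι η.toQuadraticMap (A (Module.finBasis ℝ V i)) = (2 : ℝ) • ι η.toQuadraticMap (A v) := by
    conv_rhs => rw [← h1, map_sum, Finset.smul_sum]
    exact Finset.sum_congr rfl fun i _ => by rw [map_smul, mul_smul, hs.eq v]
  have e2 : ∑ i, (2 * η v (A (Module.finBasis ℝ V i))) •
      ι η.toQuadraticMap (η.dualBasis hη (Module.finBasis ℝ V) i) =
      -((2 : ℝ) • ι η.toQuadraticMap (A v)) := by
    conv_rhs => rw [← h2, map_sum, Finset.smul_sum, ← Finset.sum_neg_distrib]
    exact Finset.sum_congr rfl fun i _ => by rw [mul_smul, skew_apply hA]; simp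
  rw [e1, e2, sub_neg_eq_add, ← add_smul, smul_smul]
  norm_num

/-- `A ↦ ¼ ∑ (A eᵢ) eⁱ` is a morphism of Lie algebras on `𝔰𝔬(V)`. It suffices that one of the two
arguments is skew-adjoint. -/
theorem spinLift_lie (hs : η.IsSymm) (hη : η.Nondegenerate) {A : Module.End ℝ V}
    (hA : A ∈ skewAdjointLieSubalgebra η) (B : Module.End ℝ V) :
    spinLift η hη ⁅A, B⁆ = ⁅spinLift η hη A, spinLift η hη B⁆ := by
  apply Subtype.ext
  have hc := spinLift_mul_ι_sub hs hη hA
  set a : CliffordAlgebra η.toQuadraticMap := (spinLift η hη A :)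
  have key : ∀ x y : V, a * (ι η.toQuadraticMap x * ι η.toQuadraticMap y) -
      ι η.toQuadraticMap x * ι η.toQuadraticMap y * a =
      ι η.toQuadraticMap (A x) * ι η.toQuadraticMap y +
        ι η.toQuadraticMap x * ι η.toQuadraticMap (A y) := fun x y => by
    rw [← hc x, ← hc y]
    noncomm_ring
  have hsk := sum_dualBasis_skew hη hA
    (((LinearMap.mul ℝ (CliffordAlgebra η.toQuadraticMap)).compl₁₂ (ι η.toQuadraticMap)
      (ι η.toQuadraticMap)).comp B)
  simp only [LinearMap.comp_apply, LinearMap.compl₁₂_apply, LinearMap.mul_apply'] at hsk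
  change _ = a * (spinLift η hη B : CliffordAlgebra η.toQuadraticMap) -
    (spinLift η hη B : CliffordAlgebra η.toQuadraticMap) * a
  rw [coe_spinLift, coe_spinLift, mul_smul_comm, smul_mul_assoc, ← smul_sub, Finset.sum_mul,
    Finset.mul_sum, ← Finset.sum_sub_distrib]
  simp only [key]
  rw [Finset.sum_add_distrib, hsk, ← sub_eq_add_neg, ← Finset.sum_sub_distrib]
  simp [LieRing.of_associative_ring_bracket, sub_mul]

theorem coe_spinLift_wedgeEnd (hs : η.IsSymm) (hη : η.Nondegenerate) {v w : V} (hvw : η v w = 0) :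
    (spinLift η hη (wedgeEnd η v w) : CliffordAlgebra η.toQuadraticMap) =
      (1 / 2 : ℝ) • (ι η.toQuadraticMap v * ι η.toQuadraticMap w) := by
  have h : ∀ x y : V, ∑ i, η x (Module.finBasis ℝ V i) • (ι η.toQuadraticMap y *
      ι η.toQuadraticMap (η.dualBasis hη (Module.finBasis ℝ V) i)) =
      ι η.toQuadraticMap y * ι η.toQuadraticMap x := fun x y => by
    conv_rhs => rw [← sum_dualBasis_left hη x, map_sum, Finset.mul_sum]
    simp
  rw [coe_spinLift]
  simp only [wedgeEnd_apply, map_sub, map_smul, sub_mul, smul_mul_assoc]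
  rw [Finset.sum_sub_distrib, h, h, ι_mul_ι_swap hs v w, hvw]
  simp only [mul_zero, map_zero, zero_sub, sub_neg_eq_add, ← two_smul ℝ, smul_smul]
  norm_num

theorem spinLift_wedgeEnd_mul_self (hs : η.IsSymm) (hη : η.Nondegenerate) {v w : V}
    (hvw : η v w = 0) :
    spinLift η hη (wedgeEnd η v w) * spinLift η hη (wedgeEnd η v w) =
      algebraMap ℝ _ (-(1 / 4) * (η v v * η w w)) := by
  apply Subtype.ext
  change (spinLift η hη (wedgeEnd η v w) : CliffordAlgebra η.toQuadraticMap) *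
    spinLift η hη (wedgeEnd η v w) = algebraMap ℝ _ _
  rw [coe_spinLift_wedgeEnd hs hη hvw, smul_mul_smul_comm, mul_assoc,
    ← mul_assoc (ι η.toQuadraticMap w), ι_mul_ι_swap hs v w, hvw, mul_zero, map_zero, zero_sub,
    neg_mul, mul_neg, mul_assoc (ι η.toQuadraticMap v) (ι η.toQuadraticMap w), ι_sq_scalar,
    ← mul_assoc (ι η.toQuadraticMap v), ι_sq_scalar, ← map_mul, Algebra.smul_def, ← map_neg,
    ← map_mul]
  congr 1
  simp only [LinearMap.BilinMap.toQuadraticMap_apply]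
  ring

end Clifford

namespace FlatModel

variable {V S : Type*} [AddCommGroup V] [Module ℝ V] [FiniteDimensional ℝ V]
  [AddCommGroup S] [Module ℝ S] (F : FlatModel V S)

/-- The spin action is a representation of `𝔰𝔬(V)`. -/
theorem spin_lie {A : Module.End ℝ V} (hA : A ∈ F.so) (B : Module.End ℝ V) :
    F.spin ⁅A, B⁆ = ⁅F.spin A, F.spin B⁆ := by
  simp only [spin, LinearMap.comp_apply, spinLift_lie F.η_symm F.η_nondeg hA]
  simp [LieRing.of_associative_ring_bracket]

theorem κ_spin {A : Module.End ℝ V} (hA : A ∈ F.so) (s t : S) :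
    A (F.κ s t) = F.κ (F.spin A s) t + F.κ s (F.spin A t) :=
  F.κ_equivariant A hA s t

theorem spin_wedgeEnd_sq {v w : V} (hvw : F.η v w = 0) (s : S) :
    F.spin (wedgeEnd F.η v w) (F.spin (wedgeEnd F.η v w) s) =
      (-(1 / 4) * (F.η v v * F.η w w)) • s := by
  have := congrArg (fun x => F.cliff x s) (spinLift_wedgeEnd_mul_self F.η_symm F.η_nondeg hvw)
  rw [map_mul, AlgHom.commutes, Module.algebraMap_end_apply] at this
  exact this

end FlatModel

/-! ### Lorentzian geometry and local homogeneity -/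

namespace FlatModel

variable {V S : Type*} [AddCommGroup V] [Module ℝ V] [FiniteDimensional ℝ V]
  [AddCommGroup S] [Module ℝ S] {F : FlatModel V S}

theorem IsLorentzian.exists_timelike (hL : F.IsLorentzian) : ∃ e, F.η e e < 0 := by
  obtain ⟨W, hW, hpos⟩ := exists_finrank_eq_sigNeg_and_negDef F.η.toQuadraticMap
  rw [hL] at hW
  have : Nontrivial W := Module.nontrivial_of_finrank_pos (R := ℝ) (by omega)
  obtain ⟨e, he⟩ := exists_ne (0 : W)
  exact ⟨e, by simpa using hpos e he⟩

/-- Two orthogonal vectors of a Lorentzian space are not both time-like. -/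
theorem IsLorentzian.nonneg_of_orthogonal (hL : F.IsLorentzian) {x y : V} (hx : F.η x x < 0)
    (hxy : F.η x y = 0) : 0 ≤ F.η y y := by
  by_contra! hy
  have hyx : F.η y x = 0 := by rw [F.η_symm.eq]; exact hxy
  have hli : LinearIndependent ℝ ![x, y] := by
    rw [LinearIndependent.pair_iff]
    intro s t h
    have h1 := congrArg (F.η x) h
    have h2 := congrArg (F.η y) h
    simp [hxy, hyx] at h1 h2
    exact ⟨h1.resolve_right hx.ne, h2.resolve_right hy.ne⟩
  have hneg : ((-F.η.toQuadraticMap).restrict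
      (Submodule.span ℝ (Set.range ![x, y]))).PosDef := by
    rintro ⟨z, hz⟩ hz0
    rw [Matrix.range_cons, Matrix.range_cons, Matrix.range_empty, Set.union_empty,
      Set.singleton_union, Submodule.mem_span_pair] at hz
    obtain ⟨s, t, rfl⟩ := hz
    have : s ≠ 0 ∨ t ≠ 0 := by
      by_contra! h
      apply hz0
      simp [h.1, h.2]
    have e : -F.η (s • x + t • y) (s • x + t • y) = s ^ 2 * -F.η x x + t ^ 2 * -F.η y y := by
      simp [hxy, hyx]
      ring
    suffices 0 < -F.η (s • x + t • y) (s • x + t • y) by simpa using this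
    rw [e]
    rcases this with h | h <;> [have := mul_pos (sq_pos_of_ne_zero h) (neg_pos.2 hx);
      have := mul_pos (sq_pos_of_ne_zero h) (neg_pos.2 hy)]
    · have := mul_nonneg (sq_nonneg t) (neg_pos.2 hy).le
      linarith
    · have := mul_nonneg (sq_nonneg s) (neg_pos.2 hx).le
      linarith
  have := le_sigNeg_of_negDef _ hneg
  rw [finrank_span_eq_card hli, hL] at this
  simp at this

/-- The orthogonal complement of a time-like vector is positive definite. -/
theorem IsLorentzian.pos_of_orthogonal (hL : F.IsLorentzian) {x y : V} (hx : F.η x x < 0)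
    (hxy : F.η x y = 0) (hy : y ≠ 0) : 0 < F.η y y := by
  refine lt_of_le_of_ne (hL.nonneg_of_orthogonal hx hxy) fun h0 => ?_
  apply hy
  refine F.η_nondeg.1 y fun z => ?_
  by_contra hyz
  -- the projection of `z` to the orthogonal complement of `x`
  set z' := z - (F.η x z / F.η x x) • x with hz'
  have hxz' : F.η x z' = 0 := by simp [hz', hx.ne]
  have hyz' : F.η y z' = F.η y z := by simp [hz', F.η_symm.eq y x, hxy]
  -- `z' + t y` would be time-like for a suitable `t`
  set t := -(F.η z' z' + 1) / (2 * F.η y z) with ht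
  have h2 : 2 * F.η y z * t = -(F.η z' z' + 1) := by
    rw [ht]; field_simp
  have := hL.nonneg_of_orthogonal hx (y := z' + t • y) (by simp [hxz', hxy])
  have e : F.η (z' + t • y) (z' + t • y) = F.η z' z' + 2 * F.η y z * t := by
    simp [F.η_symm.eq z' y, hyz', ← h0]
    ring
  rw [e, h2] at this
  linarith

/-- A non-space-like vector orthogonal to a null vector is a multiple of it. -/
theorem IsLorentzian.mem_span_of_null (hL : F.IsLorentzian) {w k : V} (hw : w ≠ 0)
    (hww : F.η w w = 0) (hwk : F.η w k = 0) (hk : F.η k k ≤ 0) : ∃ r : ℝ, k = r • w := by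
  obtain ⟨e, he⟩ := hL.exists_timelike
  have hew : F.η e w ≠ 0 := fun h => (hL.pos_of_orthogonal he h hw).ne' hww
  refine ⟨F.η e k / F.η e w, ?_⟩
  by_contra hne
  have := hL.pos_of_orthogonal he (y := k - (F.η e k / F.η e w) • w) (by simp [hew])
    (sub_ne_zero.2 hne)
  simp [F.η_symm.eq k w, hwk, hww] at this
  linarith

/-- A bilinear form that vanishes on a subspace of more than half the dimension is degenerate
there. -/
theorem exists_mem_radical [FiniteDimensional ℝ S] (B : S →ₗ[ℝ] S →ₗ[ℝ] ℝ) (W : Submodule ℝ S)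
    (hW : Module.finrank ℝ S < 2 * Module.finrank ℝ W) (hB : ∀ s ∈ W, ∀ t ∈ W, B s t = 0) :
    ∃ s ∈ W, s ≠ 0 ∧ ∀ t, B s t = 0 := by
  let f : W →ₗ[ℝ] Module.Dual ℝ S := B ∘ₗ W.subtype
  have hf : LinearMap.range f ≤ W.dualAnnihilator := by
    rintro _ ⟨s, rfl⟩
    exact (Submodule.mem_dualAnnihilator _).2 fun t ht => hB s s.2 t ht
  have h1 := Submodule.finrank_mono hf
  have h2 := Subspace.finrank_add_finrank_dualAnnihilator_eq W
  have h3 := f.finrank_range_add_finrank_ker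
  obtain ⟨s, hs, hs0⟩ := Submodule.exists_mem_ne_zero_of_ne_bot (p := LinearMap.ker f) fun h => by
    rw [h, finrank_bot] at h3
    omega
  exact ⟨s, s.2, by simpa using hs0, fun t => congrArg (fun g : Module.Dual ℝ S => g t) hs⟩

/-- No space-like vector is orthogonal to `κ(S', S')`: for a time-like `w ⊥ v`, the spin action `J`
of the boost `v ∧ w` intertwines the pairings `η(v, κ(-,-))` and `η(w, κ(-,-))`, the second of
which is anisotropic by causality. -/
theorem IsCausal.not_spacelike [FiniteDimensional ℝ S] (hL : F.IsLorentzian) (hc : F.IsCausal)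
    {W : Submodule ℝ S} (hW : Module.finrank ℝ S < 2 * Module.finrank ℝ W) {v : V}
    (hv : ∀ s ∈ W, ∀ t ∈ W, F.η v (F.κ s t) = 0) : ¬ 0 < F.η v v := by
  intro hvv
  obtain ⟨s, hsW, hs0, hs⟩ := exists_mem_radical (F.κ.compr₂ (F.η v)) W hW hv
  simp only [LinearMap.compr₂_apply] at hs
  obtain ⟨e, he⟩ := hL.exists_timelike
  set w := e - (F.η v e / F.η v v) • v with hw
  have hvw : F.η v w = 0 := by simp [hw, hvv.ne']
  have hwv : F.η w v = 0 := by rw [F.η_symm.eq]; exact hvw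
  have hww : F.η w w < 0 := by
    have : F.η w w = F.η e e - F.η v e ^ 2 / F.η v v := by
      simp [hw, F.η_symm.eq e v]
      field_simp
      ring
    rw [this]
    have := div_nonneg (sq_nonneg (F.η v e)) hvv.le
    linarith
  have hpos : ∀ t, F.η w (F.κ t t) = 0 → t = 0 := fun t ht => by
    by_contra h0
    rcases hc t h0 with h | ⟨h, h'⟩
    · exact absurd (hL.nonneg_of_orthogonal hww ht) h.not_ge
    · exact (hL.pos_of_orthogonal hww ht h).ne' h'
  set A := wedgeEnd F.η v w with hA
  set J := F.spin A with hJ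
  have hAm : A ∈ F.so := wedgeEnd_mem F.η_symm v w
  have hJJ : ∀ t, J (J t) = (-(1 / 4) * (F.η v v * F.η w w)) • t := F.spin_wedgeEnd_sq hvw
  have hAv : A v = -F.η v v • w := by simp [hA, hwv]
  have hAw : A w = F.η w w • v := by simp [hA, hvw]
  have hinv : ∀ x a b, F.η (A x) (F.κ a b) = -F.η x (F.κ (J a) b) - F.η x (F.κ a (J b)) :=
    fun x a b => by rw [skew_apply hAm, F.κ_spin hAm, map_add]; ring
  have h1 : ∀ t, F.η w (F.κ (J s) t) = -F.η w (F.κ s (J t)) := fun t => by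
    have := hinv w s t
    rw [hAw, map_smul, LinearMap.smul_apply, hs, smul_zero] at this
    linarith
  set q := -(1 / 4) * (F.η v v * F.η w w) with hq
  have hq0 : 0 < q := by
    have := mul_neg_of_pos_of_neg hvv hww
    rw [hq]; linarith
  have h2 : F.η w (F.κ (J s) (J s)) = -(q * F.η w (F.κ s s)) := by
    rw [h1, hJJ, map_smul, map_smul, smul_eq_mul]
  have h3 : F.η w (F.κ (J s) s) = 0 := by
    have := h1 s
    rw [F.κ_symm s (J s)] at this
    linarith
  -- `J s + √q s` is isotropic for the anisotropic form `η(w, κ(-,-))`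
  have h4 : J s + Real.sqrt q • s = 0 := hpos _ (by
    simp only [map_add, map_smul, LinearMap.add_apply, LinearMap.smul_apply, smul_eq_mul, h2,
      F.κ_symm s (J s), h3]
    linear_combination F.η w (F.κ s s) * Real.mul_self_sqrt hq0.le)
  have h5 : Real.sqrt q * F.η w (F.κ s s) = 0 := by
    have := congrArg (fun x => F.η w (F.κ x s)) h4
    simpa [h3] using this
  rcases mul_eq_zero.1 h5 with h | h
  · exact (Real.sqrt_pos.2 hq0).ne' h
  · exact hs0 (hpos s h)

/-- Local homogeneity: the Dirac current of a subspace of more than half the dimension is onto. -/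
theorem IsCausal.span_κ_eq_top [FiniteDimensional ℝ S] (hL : F.IsLorentzian)
    (hdim : 2 < Module.finrank ℝ V) (hc : F.IsCausal)
    {W : Submodule ℝ S} (hW : Module.finrank ℝ S < 2 * Module.finrank ℝ W) :
    Submodule.span ℝ (Set.range fun s : W => F.κ s s) = ⊤ := by
  by_contra hne
  obtain ⟨f, hf0, hf⟩ := Submodule.exists_le_ker_of_lt_top _ (lt_top_iff_ne_top.2 hne)
  -- `f` is represented by a vector `w` orthogonal to all `κ(s, s)`, hence to all `κ(s, t)`
  obtain ⟨w, rfl⟩ := (F.η.toDual F.η_nondeg).surjective f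
  have hw : ∀ s ∈ W, F.η w (F.κ s s) = 0 := fun s hs =>
    hf (Submodule.subset_span ⟨⟨s, hs⟩, rfl⟩)
  have hw0 : w ≠ 0 := by rintro rfl; simp at hf0
  have hpol : ∀ x : V, (∀ s ∈ W, F.η x (F.κ s s) = 0) → ∀ s ∈ W, ∀ t ∈ W, F.η x (F.κ s t) = 0 := by
    intro x hx s hs t ht
    have := hx (s + t) (W.add_mem hs ht)
    simp [hx s hs, hx t ht, F.κ_symm t s] at this
    linarith
  have hWpos : 0 < Module.finrank ℝ W := by omega
  obtain ⟨s, hs0⟩ : ∃ s : W, s ≠ 0 :=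
    @exists_ne _ (Module.nontrivial_of_finrank_pos (R := ℝ) hWpos) 0
  have hs0' : (s : S) ≠ 0 := by simpa using hs0
  have hκs : F.κ s s ≠ 0 := by
    rcases hc s hs0' with h | h
    · intro h0; simp [h0] at h
    · exact h.1
  have hcaus : ∀ t, F.η (F.κ t t) (F.κ t t) ≤ 0 := fun t => by
    by_cases ht : t = 0
    · simp [ht]
    · rcases hc t ht with h | h
      · exact h.le
      · exact h.2.le
  rcases lt_trichotomy (F.η w w) 0 with h | h | h
  · exact ((hL.pos_of_orthogonal h (hw s s.2) hκs).trans_le (hcaus s)).false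
  · -- `κ(s, s)` is a multiple of the null vector `w`; a space-like `u ⊥ w` is excluded as well
    obtain ⟨e, he⟩ := hL.exists_timelike
    obtain ⟨u, hu, hu0⟩ := Submodule.exists_mem_ne_zero_of_ne_bot
      (LinearMap.ker_ne_bot_of_finrank_lt (f := (F.η e).prod (F.η w)) (by simpa using hdim))
    simp only [LinearMap.mem_ker, LinearMap.prod_apply, Function.prod_apply,
      Prod.mk_eq_zero] at hu
    refine hc.not_spacelike hL hW (hpol u fun t ht => ?_) (hL.pos_of_orthogonal he hu.1 hu0)
    obtain ⟨r, hr⟩ := hL.mem_span_of_null hw0 h (hw t ht) (hcaus t)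
    rw [hr, map_smul, F.η_symm.eq u w, hu.2, smul_zero]
  · exact hc.not_spacelike hL hW (hpol w hw) h

end FlatModel

/-! ### Lie superalgebras generated by odd elements -/

section Superbracket

variable {L : Type*} [AddCommGroup L] [Module ℝ L]

/-- A super-skew bracket for which odd elements satisfy the Jacobi identities satisfies the
remaining identity, for three even elements, as soon as it does so on a subspace `G` which together
with the brackets `[s, s]` of odd elements spans the even part: for even `x`, `y` the operator
`[ad x, ad y] - ad [x, y]` kills `[s, s]`, and the Jacobiator of even elements is invariant under
cyclic permutations. -/
theorem IsLieSuperbracket.of_generated {P : ZMod 2 → Submodule ℝ L} {b : L →ₗ[ℝ] L →ₗ[ℝ] L}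
    {G : Submodule ℝ L} (hP : DirectSum.IsInternal P)
    (parity : ∀ p q, ∀ x ∈ P p, ∀ y ∈ P q, b x y ∈ P (p + q))
    (skew : ∀ x ∈ P 0, ∀ y, b x y = -b y x) (symm : ∀ s ∈ P 1, ∀ t ∈ P 1, b s t = b t s)
    (hG : G ≤ P 0) (hgen : P 0 ≤ G ⊔ Submodule.span ℝ {z | ∃ s ∈ P 1, z = b s s})
    (jacG : ∀ x ∈ G, ∀ y ∈ G, ∀ z ∈ G, b x (b y z) = b (b x y) z + b y (b x z))
    (jac001 : ∀ x ∈ P 0, ∀ y ∈ P 0, ∀ s ∈ P 1, b x (b y s) = b (b x y) s + b y (b x s))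
    (jac011 : ∀ x ∈ P 0, ∀ s ∈ P 1, b x (b s s) = (2 : ℝ) • b (b x s) s)
    (jac111 : ∀ s ∈ P 1, b (b s s) s = 0) : IsLieSuperbracket P b := by
  have p00 : ∀ x ∈ P 0, ∀ y ∈ P 0, b x y ∈ P 0 := fun x hx y hy => parity 0 0 x hx y hy
  have p01 : ∀ x ∈ P 0, ∀ y ∈ P 1, b x y ∈ P 1 := fun x hx y hy => parity 0 1 x hx y hy
  have p11 : ∀ x ∈ P 1, ∀ y ∈ P 1, b x y ∈ P 0 := fun x hx y hy => parity 1 1 x hx y hy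
  have two : ∀ p : ZMod 2, p = 0 ∨ p = 1 := by decide
  have k0 : ∀ q, koszulSign 0 q = 1 := fun q => by simp [koszulSign]
  have k10 : koszulSign 1 0 = 1 := by simp [koszulSign]
  have k11 : koszulSign 1 1 = -1 := by simp [koszulSign]
  have jac011' : ∀ x ∈ P 0, ∀ s ∈ P 1, ∀ t ∈ P 1, b x (b s t) = b (b x s) t + b s (b x t) := by
    intro x hx s hs t ht
    have h1 := jac011 x hx (s + t) (add_mem hs ht)
    have h2 := jac011 x hx s hs
    have h3 := jac011 x hx t ht
    simp only [map_add, LinearMap.add_apply, symm t ht s hs, symm _ (p01 x hx t ht) s hs] at h1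
    linear_combination (norm := module) (1 / 2 : ℝ) • h1 - (1 / 2 : ℝ) • h2 - (1 / 2 : ℝ) • h3
  -- the polarisation of a cubic form
  have jac111' : ∀ s ∈ P 1, ∀ t ∈ P 1, ∀ u ∈ P 1,
      b (b s t) u + b (b t u) s + b (b u s) t = 0 := by
    intro s hs t ht u hu
    have h1 := jac111 _ (add_mem (add_mem hs ht) hu)
    have h2 := jac111 _ (add_mem hs ht)
    have h3 := jac111 _ (add_mem hs hu)
    have h4 := jac111 _ (add_mem ht hu)
    have h5 := jac111 _ hs
    have h6 := jac111 _ ht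
    have h7 := jac111 _ hu
    simp only [map_add, LinearMap.add_apply, symm t ht s hs, symm u hu t ht, symm s hs u hu]
      at h1 h2 h3 h4
    linear_combination (norm := module) (1 / 2 : ℝ) • h1 - (1 / 2 : ℝ) • h2 - (1 / 2 : ℝ) • h3
      - (1 / 2 : ℝ) • h4 + (1 / 2 : ℝ) • h5 + (1 / 2 : ℝ) • h6 + (1 / 2 : ℝ) • h7
  -- `[ad x, ad y] - ad [x, y]` kills the brackets `[s, s]`
  have jacS : ∀ x ∈ P 0, ∀ y ∈ P 0, ∀ z ∈ Submodule.span ℝ {z | ∃ s ∈ P 1, z = b s s},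
      b x (b y z) = b (b x y) z + b y (b x z) := by
    intro x hx y hy z hz
    induction hz using Submodule.span_induction with
    | mem z hz =>
      obtain ⟨s, hs, rfl⟩ := hz
      have h1 := jac011' x hx _ (p01 y hy s hs) s hs
      have h2 := jac011' y hy _ (p01 x hx s hs) s hs
      have h3 := congrArg (fun z => b z s) (jac001 x hx y hy s hs)
      simp only [map_add, LinearMap.add_apply] at h3
      rw [jac011 y hy s hs, jac011 x hx s hs, jac011 _ (p00 x hx y hy) s hs, map_smul, map_smul]
      rw [symm _ (p01 y hy s hs) _ (p01 x hx s hs)] at h1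
      linear_combination (norm := module) (2 : ℝ) • h1 - (2 : ℝ) • h2 + (2 : ℝ) • h3
    | zero => simp
    | add z z' _ _ h h' => simp only [map_add, h, h']; abel
    | smul c z _ h => simp only [map_smul, h, smul_add]
  -- cyclic invariance moves each argument in turn to the last place, where it is reduced to `G`
  have cyc : ∀ x ∈ P 0, ∀ y ∈ P 0, ∀ z ∈ P 0, b y (b z x) = b (b y z) x + b z (b y x) →
      b x (b y z) = b (b x y) z + b y (b x z) := by
    intro x hx y hy z hz h
    rw [skew _ (p00 y hy z hz) x, skew y hy x, skew z hz x, map_neg, map_neg,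
      skew z hz (b x y)] at h
    linear_combination (norm := module) h
  have red : ∀ x ∈ P 0, ∀ y ∈ P 0, ∀ z ∈ P 0,
      (∀ g ∈ G, b x (b y g) = b (b x y) g + b y (b x g)) →
      b x (b y z) = b (b x y) z + b y (b x z) := by
    intro x hx y hy z hz h
    obtain ⟨g, hg, k, hk, rfl⟩ := Submodule.mem_sup.1 (hgen hz)
    simp only [map_add, h g hg, jacS x hx y hy k hk]
    abel
  have jac000 : ∀ x ∈ P 0, ∀ y ∈ P 0, ∀ z ∈ P 0, b x (b y z) = b (b x y) z + b y (b x z) := by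
    intro x hx y hy z hz
    refine red x hx y hy z hz fun g hg => cyc x hx y hy g (hG hg) ?_
    refine red y hy g (hG hg) x hx fun g' hg' => cyc y hy g (hG hg) g' (hG hg') ?_
    exact red g (hG hg) g' (hG hg') y hy fun g'' hg'' => jacG g hg g' hg' g'' hg''
  have skew1 : ∀ s ∈ P 1, ∀ y ∈ P 0, b s y = -b y s := fun s hs y hy => by
    rw [skew y hy s, neg_neg]
  refine ⟨hP, parity, fun p q x hx y hy => ?_, fun p q x hx y hy z => ?_⟩
  · rcases two p with rfl | rfl
    · rw [k0, one_smul, skew x hx y]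
    · rcases two q with rfl | rfl
      · rw [k10, one_smul, skew1 x hx y hy]
      · rw [k11, neg_one_smul, neg_neg, symm x hx y hy]
  · have hz : z ∈ P 0 ⊔ P 1 := by
      have : (⨆ i, P i) ≤ P 0 ⊔ P 1 := iSup_le fun i => by
        rcases two i with rfl | rfl
        · exact le_sup_left
        · exact le_sup_right
      exact this (hP.submodule_iSup_eq_top ▸ Submodule.mem_top)
    obtain ⟨e, he, o, ho, rfl⟩ := Submodule.mem_sup.1 hz
    suffices b x (b y e) = b (b x y) e + koszulSign p q • b y (b x e) ∧
        b x (b y o) = b (b x y) o + koszulSign p q • b y (b x o) by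
      simp only [map_add, this.1, this.2, smul_add]
      abel
    rcases two p with rfl | rfl <;> rcases two q with rfl | rfl
    · rw [k0, one_smul, one_smul]
      exact ⟨jac000 x hx y hy e he, jac001 x hx y hy o ho⟩
    · rw [k0, one_smul, one_smul]
      refine ⟨?_, jac011' x hx y hy o ho⟩
      have h := jac001 x hx e he y hy
      rw [skew1 y hy e he, map_neg, skew1 _ (p01 x hx y hy) e he,
        skew1 y hy _ (p00 x hx e he)]
      linear_combination (norm := module) -h
    · rw [k10, one_smul, one_smul]
      constructor
      · have h := jac001 y hy e he x hx
        rw [skew1 x hx _ (p00 y hy e he), skew1 x hx y hy, skew1 x hx e he, map_neg, map_neg,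
          LinearMap.neg_apply, skew1 _ (p01 y hy x hx) e he]
        linear_combination (norm := module) h
      · have h := jac011' y hy x hx o ho
        rw [skew1 x hx y hy, map_neg, LinearMap.neg_apply]
        linear_combination (norm := module) -h
    · rw [k11, neg_one_smul, neg_one_smul]
      constructor
      · have h := jac011' e he x hx y hy
        rw [skew1 y hy e he, skew1 x hx e he, map_neg, map_neg, skew _ (p11 x hx y hy) e,
          symm y hy _ (p01 e he x hx)]
        linear_combination (norm := module) h
      · have h := jac111' x hx y hy o ho
        rw [skew1 x hx _ (p11 y hy o ho), skew1 y hy _ (p11 x hx o ho), symm x hx o ho]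
        linear_combination (norm := module) -h

end Superbracket

/-! ### Cocycles and their curvature -/

/-- A Lie algebra `G` acting on `V` and `S` together with an equivariant symmetric bilinear map
`κ : S × S → V`. This is the structure of the graded Lie superalgebra `V ⊕ S ⊕ G`. -/
structure DiracModule (G V S : Type*) [LieRing G] [LieAlgebra ℝ G] [AddCommGroup V] [Module ℝ V]
    [AddCommGroup S] [Module ℝ S] where
  ρV : G →ₗ⁅ℝ⁆ Module.End ℝ V
  ρS : G →ₗ⁅ℝ⁆ Module.End ℝ S
  κ : S →ₗ[ℝ] S →ₗ[ℝ] V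
  κ_symm : ∀ s t, κ s t = κ t s
  κ_equivariant : ∀ X s t, ρV X (κ s t) = κ (ρS X s) t + κ s (ρS X t)

namespace DiracModule

variable {G V S : Type*} [LieRing G] [LieAlgebra ℝ G] [AddCommGroup V] [Module ℝ V]
  [AddCommGroup S] [Module ℝ S] (D : DiracModule G V S)

/-- A Spencer `(2,2)`-cocycle `α + β + γ` of `V ⊕ S` with values in `V ⊕ S ⊕ G` which is invariant
up to coboundaries: `X · (α + β + γ) = ∂ (τ X)` for `τ X : V → G`. Only the components of this
equation along `β` and `γ` are recorded. -/
structure Cocycle where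
  α : V →ₗ[ℝ] V →ₗ[ℝ] V
  β : V →ₗ[ℝ] S →ₗ[ℝ] S
  γ : S →ₗ[ℝ] S →ₗ[ℝ] G
  τ : G →ₗ[ℝ] V →ₗ[ℝ] G
  α_self : ∀ v, α v v = 0
  γ_symm : ∀ s t, γ s t = γ t s
  cocycle₁ : ∀ v s, α (D.κ s s) v + (2 : ℝ) • D.κ s (β v s) + D.ρV (γ s s) v = 0
  cocycle₂ : ∀ s, β (D.κ s s) s + D.ρS (γ s s) s = 0
  invariant_β : ∀ X v s, D.ρS X (β v s) - β (D.ρV X v) s - β v (D.ρS X s) = D.ρS (τ X v) s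
  invariant_γ : ∀ X s t, ⁅X, γ s t⁆ - γ (D.ρS X s) t - γ s (D.ρS X t) = -τ X (D.κ s t)

variable {D}

namespace Cocycle

theorem α_swap (c : D.Cocycle) (v w : V) : α c w v = -α c v w := by
  have h := c.α_self (v + w)
  simp only [map_add, LinearMap.add_apply, c.α_self, zero_add, add_zero] at h
  exact eq_neg_of_add_eq_zero_left h

/-- `δ : V × V → G` is the degree-`4` component of a filtered deformation with infinitesimal part
`c`: the two equations are the Jacobi identities for arguments in `V, S, S` and `V, V, S`. -/
structure IsCurvature (c : D.Cocycle) (δ : V →ₗ[ℝ] V →ₗ[ℝ] G) : Prop where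
  apply_κ : ∀ v s, δ v (D.κ s s) = (2 : ℝ) • c.γ s (c.β v s) + c.τ (c.γ s s) v
  act : ∀ v w s, D.ρS (δ v w) s = c.β v (c.β w s) - c.β w (c.β v s) - c.β (c.α v w) s

/-- On `S` the action of `δ v v` is the commutator of `β v` with itself. -/
theorem IsCurvature.self_eq_zero {c : D.Cocycle} {δ : V →ₗ[ℝ] V →ₗ[ℝ] G} (h : c.IsCurvature δ)
    (hfaith : ∀ X, (∀ s, D.ρS X s = 0) → X = 0) (v : V) : δ v v = 0 :=
  hfaith _ fun s => by simp [h.act, c.α_self]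

/-- `c' = c + ∂ν`. No condition on `τ` is needed, see `IsShift.τ`. -/
structure IsShift (c c' : D.Cocycle) (ν : V →ₗ[ℝ] G) : Prop where
  α : ∀ v w, c'.α v w = c.α v w + D.ρV (ν v) w - D.ρV (ν w) v
  β : ∀ v s, c'.β v s = c.β v s + D.ρS (ν v) s
  γ : ∀ s t, c'.γ s t = c.γ s t - ν (D.κ s t)

/-- The equivariance defect `τ` is determined by `γ`, hence changes by `X · ν`. -/
theorem IsShift.τ {c c' : D.Cocycle} {ν : V →ₗ[ℝ] G} (h : c.IsShift c' ν)
    (hspan : Submodule.span ℝ (Set.range fun s => D.κ s s) = ⊤) (X : G) (v : V) :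
    c'.τ X v = c.τ X v + ⁅X, ν v⁆ - ν (D.ρV X v) := by
  have hv : v ∈ Submodule.span ℝ (Set.range fun s => D.κ s s) := hspan ▸ Submodule.mem_top
  induction hv using Submodule.span_induction with
  | mem v hv =>
    obtain ⟨s, rfl⟩ := hv
    have h1 := c.invariant_γ X s s
    have h2 := c'.invariant_γ X s s
    simp only [h.γ, lie_sub] at h2
    simp only [D.κ_equivariant, map_add]
    linear_combination (norm := module) h2 - h1
  | zero => simp
  | add v w _ _ h1 h2 => simp only [map_add, lie_add, h1, h2]; abel
  | smul k v _ h1 => simp only [map_smul, lie_smul, h1, smul_add, smul_sub]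

/-- The existence of a curvature depends only on the cohomology class. Adding `∂ν` to the cocycle
corresponds to the new complement `{v + ν v}` of `S ⊕ G`, which dictates the formula for `δ'`. -/
theorem IsShift.exists_isCurvature {c c' : D.Cocycle} {ν : V →ₗ[ℝ] G} (h : c.IsShift c' ν)
    (hspan : Submodule.span ℝ (Set.range fun s => D.κ s s) = ⊤) {δ : V →ₗ[ℝ] V →ₗ[ℝ] G}
    (hδ : c.IsCurvature δ) : ∃ δ', c'.IsCurvature δ' := by
  let δ' : V →ₗ[ℝ] V →ₗ[ℝ] G := LinearMap.mk₂ ℝ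
    (fun v w => δ v w + c.τ (ν v) w - c.τ (ν w) v + ⁅ν v, ν w⁆ - ν (c.α v w)
      - ν (D.ρV (ν v) w - D.ρV (ν w) v))
    (fun v v' w => by simp; abel) (fun k v w => by simp [smul_sub, smul_add])
    (fun v w w' => by simp; abel) (fun k v w => by simp [smul_sub, smul_add])
  have e : ∀ v w, δ' v w = δ v w + c.τ (ν v) w - c.τ (ν w) v + ⁅ν v, ν w⁆ - ν (c.α v w)
      - ν (D.ρV (ν v) w - D.ρV (ν w) v) := fun v w => rfl
  refine ⟨δ', fun v s => ?_, fun v w s => ?_⟩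
  · have h1 := hδ.apply_κ v s
    have h2 := c.invariant_γ (ν v) s s
    have h3 := congrArg ν (c.cocycle₁ v s)
    have h4 := congrArg ν (D.κ_equivariant (ν v) s s)
    rw [c.γ_symm (D.ρS (ν v) s) s, ← lie_skew] at h2
    rw [D.κ_symm (D.ρS (ν v) s) s] at h4
    rw [c.α_swap v] at h3
    simp only [e, h.τ hspan, h.β, h.γ, map_add, map_sub, LinearMap.sub_apply, map_neg,
      map_smul, map_zero, ← lie_skew (ν v) (ν _)] at h1 h2 h3 h4 ⊢
    linear_combination (norm := module) h1 + h2 + h3 - h4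
  · have h1 := hδ.act v w s
    have h2 := c.invariant_β (ν v) w s
    have h3 := c.invariant_β (ν w) v s
    simp only [e, h.α, h.β, map_add, map_sub, LinearMap.add_apply, LinearMap.sub_apply,
      LieHom.map_lie, LieRing.of_associative_ring_bracket, Module.End.mul_apply]
    linear_combination (norm := module) h1 - h2 + h3

end Cocycle
end DiracModule

/-! ### The deformed bracket -/

namespace DiracModule

variable {G V S : Type*} [LieRing G] [LieAlgebra ℝ G] [AddCommGroup V] [Module ℝ V]
  [AddCommGroup S] [Module ℝ S] {D : DiracModule G V S}

namespace Cocycle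

/-- The bracket on `V ⊕ S ⊕ G` with components of degree `0` from `D`, of degree `2` from `c` and
of degree `4` from `δ`. -/
def bracket (c : D.Cocycle) (δ : V →ₗ[ℝ] V →ₗ[ℝ] G) :
    (V × S × G) →ₗ[ℝ] (V × S × G) →ₗ[ℝ] (V × S × G) :=
  LinearMap.mk₂ ℝ (fun x y =>
    (D.ρV x.2.2 y.1 - D.ρV y.2.2 x.1 + D.κ x.2.1 y.2.1 + c.α x.1 y.1,
      D.ρS x.2.2 y.2.1 - D.ρS y.2.2 x.2.1 + c.β x.1 y.2.1 - c.β y.1 x.2.1,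
      ⁅x.2.2, y.2.2⁆ + c.γ x.2.1 y.2.1 + c.τ x.2.2 y.1 - c.τ y.2.2 x.1 + δ x.1 y.1))
    (fun x x' y => by ext <;> simp <;> abel)
    (fun k x y => by ext <;> simp [smul_sub, smul_add])
    (fun x y y' => by ext <;> simp <;> abel)
    (fun k x y => by ext <;> simp [smul_sub, smul_add])

theorem bracket_apply (c : D.Cocycle) (δ : V →ₗ[ℝ] V →ₗ[ℝ] G) (v w : V) (s t : S) (X Y : G) :
    c.bracket δ (v, s, X) (w, t, Y) =
    (D.ρV X w - D.ρV Y v + D.κ s t + c.α v w,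
      D.ρS X t - D.ρS Y s + c.β v t - c.β w s,
      ⁅X, Y⁆ + c.γ s t + c.τ X w - c.τ Y v + δ v w) := rfl

theorem isLieSuperbracket {c : D.Cocycle} {δ : V →ₗ[ℝ] V →ₗ[ℝ] G} (hδ : c.IsCurvature δ)
    (hself : ∀ v, δ v v = 0)
    (hspan : Submodule.span ℝ (Set.range fun s => D.κ s s) = ⊤)
    {P : ZMod 2 → Submodule ℝ (V × S × G)} (hP : DirectSum.IsInternal P)
    (hP0 : ∀ x, x ∈ P 0 ↔ x.2.1 = 0) (hP1 : ∀ x, x ∈ P 1 ↔ x.1 = 0 ∧ x.2.2 = 0) :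
    IsLieSuperbracket P (c.bracket δ) := by
  have two : ∀ p : ZMod 2, p = 0 ∨ p = 1 := by decide
  have hδs : ∀ v w, δ w v = -δ v w := fun v w => by
    have h := hself (v + w)
    simp only [map_add, LinearMap.add_apply, hself, zero_add, add_zero] at h
    exact eq_neg_of_add_eq_zero_left h
  have hpar : ∀ p q : ZMod 2, ∀ x ∈ P p, ∀ y ∈ P q, c.bracket δ x y ∈ P (p + q) := by
    rintro p q ⟨v, s, X⟩ hx ⟨w, t, Y⟩ hy
    rcases two p with rfl | rfl <;> rcases two q with rfl | rfl
    · rw [hP0] at hx hy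
      rw [add_zero, hP0]
      simp only at hx hy
      simp [bracket_apply, hx, hy]
    · rw [hP0] at hx
      rw [hP1] at hy
      rw [zero_add, hP1]
      simp only at hx hy
      simp [bracket_apply, hx, hy.1, hy.2]
    · rw [hP1] at hx
      rw [hP0] at hy
      rw [add_zero, hP1]
      simp only at hx hy
      simp [bracket_apply, hx.1, hx.2, hy]
    · rw [hP1] at hx hy
      rw [show (1 + 1 : ZMod 2) = 0 from rfl, hP0]
      simp only at hx hy
      simp [bracket_apply, hx.1, hx.2, hy.1, hy.2]
  refine IsLieSuperbracket.of_generated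
    (G := LinearMap.range (LinearMap.inr ℝ V (S × G) ∘ₗ LinearMap.inr ℝ S G)) hP hpar
    ?_ ?_ ?_ ?_ ?_ ?_ ?_ ?_
  · rintro ⟨v, s, X⟩ hx ⟨w, t, Y⟩
    obtain rfl : s = 0 := (hP0 _).1 hx
    simp only [bracket_apply, map_zero, LinearMap.zero_apply, c.α_swap v w, hδs v w, Prod.neg_mk,
      ← lie_skew X Y, Prod.mk.injEq]
    refine ⟨?_, ?_, ?_⟩ <;> abel
  · rintro ⟨v, s, X⟩ hx ⟨w, t, Y⟩ hy
    obtain ⟨rfl, rfl⟩ : v = 0 ∧ X = 0 := (hP1 _).1 hx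
    obtain ⟨rfl, rfl⟩ : w = 0 ∧ Y = 0 := (hP1 _).1 hy
    simp [bracket_apply, D.κ_symm s t, c.γ_symm s t]
  · rintro _ ⟨X, rfl⟩
    simp [hP0]
  · rintro ⟨v, s, X⟩ hx
    obtain rfl : s = 0 := (hP0 _).1 hx
    have hv : v ∈ Submodule.span ℝ (Set.range fun s => D.κ s s) := hspan ▸ Submodule.mem_top
    induction hv using Submodule.span_induction generalizing X with
    | mem v hv =>
      obtain ⟨s, rfl⟩ := hv
      have : (D.κ s s, 0, X) = (0, 0, X - c.γ s s) + c.bracket δ (0, s, 0) (0, s, 0) := by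
        simp [bracket_apply]
      simp only [this]
      exact Submodule.add_mem_sup ⟨X - c.γ s s, rfl⟩
        (Submodule.subset_span ⟨(0, s, 0), by simp [hP1], rfl⟩)
    | zero => exact Submodule.mem_sup_left ⟨X, rfl⟩
    | add v w _ _ h h' =>
      have := add_mem (h X ((hP0 _).2 rfl)) (h' 0 ((hP0 _).2 rfl))
      simpa using this
    | smul k v _ h =>
      have h0 := Submodule.smul_mem _ k (h 0 ((hP0 _).2 rfl))
      have h1 : ((0, 0, X) : V × S × G) ∈ LinearMap.range
        (LinearMap.inr ℝ V (S × G) ∘ₗ LinearMap.inr ℝ S G) := ⟨X, rfl⟩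
      have := add_mem h0 (Submodule.mem_sup_left h1)
      simpa using this
  · rintro _ ⟨X, rfl⟩ _ ⟨Y, rfl⟩ _ ⟨Z, rfl⟩
    simp [bracket_apply]
  · rintro ⟨v, s₀, X⟩ hx ⟨w, t, Y⟩ hy ⟨u, s, Z⟩ hs
    obtain rfl : s₀ = 0 := (hP0 _).1 hx
    obtain rfl : t = 0 := (hP0 _).1 hy
    obtain ⟨rfl, rfl⟩ : u = 0 ∧ Z = 0 := (hP1 _).1 hs
    have h1 := hδ.act v w s
    have h2 := c.invariant_β X w s
    have h3 := c.invariant_β Y v s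
    simp only [bracket_apply, map_zero, LinearMap.zero_apply, map_add, map_sub, lie_zero,
      LinearMap.add_apply, LinearMap.sub_apply, LieHom.map_lie, add_zero, sub_zero,
      LieRing.of_associative_ring_bracket, Module.End.mul_apply, Prod.mk_add_mk, Prod.mk.injEq,
      true_and, and_true]
    linear_combination (norm := module) h2 - h3 - h1
  · rintro ⟨v, s₀, X⟩ hx ⟨u, s, Z⟩ hs
    obtain rfl : s₀ = 0 := (hP0 _).1 hx
    obtain ⟨rfl, rfl⟩ : u = 0 ∧ Z = 0 := (hP1 _).1 hs
    have h1 := hδ.apply_κ v s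
    have h2 := c.cocycle₁ v s
    have h3 := c.invariant_γ X s s
    have h4 := D.κ_equivariant X s s
    rw [D.κ_symm (D.ρS X s) s] at h4
    rw [c.γ_symm (D.ρS X s) s] at h3
    rw [c.α_swap v] at h2
    simp only [bracket_apply, map_zero, LinearMap.zero_apply, map_add, lie_zero,
      LinearMap.add_apply, add_zero, sub_zero, zero_add, Prod.smul_mk,
      Prod.mk.injEq, smul_zero, true_and, D.κ_symm _ s, c.γ_symm _ s]
    constructor
    · linear_combination (norm := module) h4 - h2
    · linear_combination (norm := module) h1 + h3
  · rintro ⟨v, s, X⟩ hx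
    obtain ⟨rfl, rfl⟩ : v = 0 ∧ X = 0 := (hP1 _).1 hx
    have h1 := c.cocycle₂ s
    simp only [bracket_apply, map_zero, LinearMap.zero_apply, lie_zero, add_zero,
      sub_zero, zero_add, Prod.mk_eq_zero, true_and, and_true, sub_self]
    rw [← h1]
    abel

end Cocycle

variable (D) in
/-- The zero cocycle, whose deformation is the graded bracket itself. -/
def zeroCocycle : D.Cocycle where
  α := 0
  β := 0
  γ := 0
  τ := 0
  α_self := by simp
  γ_symm := by simp
  cocycle₁ := by simp
  cocycle₂ := by simp
  invariant_β := by simp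
  invariant_γ := by simp

theorem isCurvature_zero : D.zeroCocycle.IsCurvature 0 :=
  ⟨by simp [zeroCocycle], by simp [zeroCocycle]⟩

end DiracModule

/-! ### Gradings and filtrations -/

section Filtered

variable {L : Type*} [AddCommGroup L] [Module ℝ L]

theorem le_gradingFiltration (𝒜 : ℤ → Submodule ℝ L) {i j : ℤ} (h : i ≤ j) :
    𝒜 j ≤ gradingFiltration 𝒜 i :=
  le_iSup₂_of_le j h le_rfl

theorem gradingFiltration_antitone (𝒜 : ℤ → Submodule ℝ L) : Antitone (gradingFiltration 𝒜) :=
  fun _ _ h => iSup₂_le fun _ hk => le_gradingFiltration 𝒜 (h.trans hk)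

/-- A bracket with the right associated graded bracket is filtered. -/
theorem IsFilteredDeformation.of_assocGraded {𝒜 : ℤ → Submodule ℝ L} {b₀ b : L →ₗ[ℝ] L →ₗ[ℝ] L}
    (base : IsGradedLieSuperbracket 𝒜 b₀) (lie : IsLieSuperbracket (parityPart 𝒜) b)
    (h : ∀ i j, ∀ x ∈ 𝒜 i, ∀ y ∈ 𝒜 j, b x y - b₀ x y ∈ gradingFiltration 𝒜 (i + j + 1)) :
    IsFilteredDeformation 𝒜 b₀ b := by
  refine ⟨base, lie, fun i j x hx y hy => ?_, h⟩
  have h1 : gradingFiltration 𝒜 i ≤ (gradingFiltration 𝒜 (i + j)).comap (b.flip y) := by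
    refine iSup₂_le fun k hk x hx => ?_
    have h2 : gradingFiltration 𝒜 j ≤ (gradingFiltration 𝒜 (i + j)).comap (b x) := by
      refine iSup₂_le fun l hl y hy => ?_
      have h3 := gradingFiltration_antitone 𝒜 (by omega : i + j ≤ k + l + 1) (h k l x hx y hy)
      have h4 := le_gradingFiltration 𝒜 (by omega : i + j ≤ k + l) (base.graded k l x hx y hy)
      simpa using add_mem h3 h4
    exact h2 hy
  exact h1 hx

end Filtered

namespace FlatModel.GradedSubalgebra

variable {V S : Type*} [AddCommGroup V] [Module ℝ V] [FiniteDimensional ℝ V]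
  [AddCommGroup S] [Module ℝ S] {F : FlatModel V S} (a : F.GradedSubalgebra)

theorem mem_grading (i : ℤ) (x : a.Carrier) : x ∈ a.grading i ↔
    (i ≠ -2 → x.1 = 0) ∧ (i ≠ -1 → x.2.1 = 0) ∧ (i ≠ 0 → x.2.2 = 0) := by
  obtain ⟨v, s, A, r⟩ := x
  unfold grading
  split_ifs with h1 h2 h3
  · subst h1
    simp [inV, Prod.ext_iff, eq_comm]
  · subst h2
    simp [inS, Prod.ext_iff, eq_comm]
  · subst h3
    simp only [Submodule.mem_sup, LinearMap.mem_range]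
    constructor
    · rintro ⟨_, ⟨A', rfl⟩, _, ⟨r', rfl⟩, h⟩
      simp [inH, inR] at h
      simp [← h.1, ← h.2.1]
    · rintro ⟨h, h', -⟩
      refine ⟨_, ⟨A, rfl⟩, _, ⟨r, rfl⟩, ?_⟩
      have e1 : v = 0 := h (by decide)
      have e2 : s = 0 := h' (by decide)
      simp [inH, inR, e1, e2]
  · simp [h1, h2, h3]

/-- The decomposition of an element into its homogeneous components. -/
theorem eq_add (x : a.Carrier) : x = (x.1, 0) + (0, x.2.1, 0) + (0, 0, x.2.2) := by simp

/-- Membership in a submodule can be checked on the homogeneous components that do not vanish. -/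
theorem mem_of_components {M : Submodule ℝ a.Carrier} {x : a.Carrier}
    (h2 : x.1 = 0 ∨ a.grading (-2) ≤ M) (h1 : x.2.1 = 0 ∨ a.grading (-1) ≤ M)
    (h0 : x.2.2 = 0 ∨ a.grading 0 ≤ M) : x ∈ M := by
  rw [a.eq_add x]
  refine add_mem (add_mem ?_ ?_) ?_
  · rcases h2 with h | h
    · rw [h]; exact M.zero_mem
    · exact h ((a.mem_grading _ _).2 (by simp))
  · rcases h1 with h | h
    · rw [h]; exact M.zero_mem
    · exact h ((a.mem_grading _ _).2 (by simp))
  · rcases h0 with h | h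
    · rw [h]; exact M.zero_mem
    · exact h ((a.mem_grading _ _).2 (by simp))

theorem mem_gradingFiltration {i : ℤ} {x : a.Carrier} (h2 : -2 < i → x.1 = 0)
    (h1 : -1 < i → x.2.1 = 0) (h0 : 0 < i → x.2.2 = 0) : x ∈ gradingFiltration a.grading i := by
  refine a.mem_of_components ?_ ?_ ?_
  · exact (lt_or_ge (-2) i).imp h2 fun h => le_gradingFiltration _ h
  · exact (lt_or_ge (-1) i).imp h1 fun h => le_gradingFiltration _ h
  · exact (lt_or_ge 0 i).imp h0 fun h => le_gradingFiltration _ h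

theorem grading_isInternal : DirectSum.IsInternal a.grading := by
  rw [DirectSum.isInternal_submodule_iff_iSupIndep_and_iSup_eq_top]
  refine ⟨fun i => ?_, ?_⟩
  · let K : Submodule ℝ a.Carrier :=
      { carrier := {x | (i = -2 → x.1 = 0) ∧ (i = -1 → x.2.1 = 0) ∧ (i = 0 → x.2.2 = 0)}
        add_mem' := by
          rintro x y ⟨h1, h2, h3⟩ ⟨k1, k2, k3⟩
          exact ⟨fun h => by simp [h1 h, k1 h], fun h => by simp [h2 h, k2 h],
            fun h => by simp [h3 h, k3 h]⟩
        zero_mem' := by simp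
        smul_mem' := by
          rintro c x ⟨h1, h2, h3⟩
          exact ⟨fun h => by simp [h1 h], fun h => by simp [h2 h], fun h => by simp [h3 h]⟩ }
    have hK : (⨆ (j) (_ : j ≠ i), a.grading j) ≤ K := iSup₂_le fun j hj x hx => by
      obtain ⟨h1, h2, h3⟩ := (a.mem_grading j x).1 hx
      exact ⟨fun h => h1 (h ▸ hj), fun h => h2 (h ▸ hj), fun h => h3 (h ▸ hj)⟩
    rw [Submodule.disjoint_def]
    intro x hx hx'
    obtain ⟨h1, h2, h3⟩ := (a.mem_grading i x).1 hx
    obtain ⟨k1, k2, k3⟩ := hK hx'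
    rw [a.eq_add x, (em _).elim k1 h1, (em _).elim k2 h2, (em _).elim k3 h3]
    simp
  · exact eq_top_iff.2 fun x _ => a.mem_of_components (.inr (le_iSup a.grading _))
      (.inr (le_iSup a.grading _)) (.inr (le_iSup a.grading _))

theorem mem_parityPart_zero (x : a.Carrier) : x ∈ parityPart a.grading 0 ↔ x.2.1 = 0 := by
  constructor
  · have : parityPart a.grading 0 ≤ LinearMap.ker
        (LinearMap.fst ℝ a.S' (a.h × a.r') ∘ₗ LinearMap.snd ℝ V _) :=
      iSup₂_le fun i hi x hx => ((a.mem_grading i x).1 hx).2.1 (by rintro rfl; revert hi; decide)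
    exact fun h => this h
  · exact fun h => a.mem_of_components (.inr (le_iSup₂_of_le (-2) (by decide) le_rfl)) (.inl h)
      (.inr (le_iSup₂_of_le 0 (by decide) le_rfl))

theorem mem_parityPart_one (x : a.Carrier) :
    x ∈ parityPart a.grading 1 ↔ x.1 = 0 ∧ x.2.2 = 0 := by
  constructor
  · have : parityPart a.grading 1 ≤ LinearMap.ker (LinearMap.fst ℝ V _) ⊓ LinearMap.ker
        (LinearMap.snd ℝ a.S' (a.h × a.r') ∘ₗ LinearMap.snd ℝ V _) :=
      iSup₂_le fun i hi x hx => ⟨((a.mem_grading i x).1 hx).1 (by rintro rfl; revert hi; decide),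
        ((a.mem_grading i x).1 hx).2.2 (by rintro rfl; revert hi; decide)⟩
    exact fun h => this h
  · exact fun h => a.mem_of_components (.inl h.1)
      (.inr (le_iSup₂_of_le (-1) (by decide) le_rfl)) (.inl h.2)

theorem parityPart_isInternal : DirectSum.IsInternal (parityPart a.grading) := by
  have two : ∀ p : ZMod 2, p = 0 ∨ p = 1 := by decide
  have hd : Disjoint (parityPart a.grading 0) (parityPart a.grading 1) := by
    rw [Submodule.disjoint_def]
    intro x h0 h1
    rw [mem_parityPart_zero] at h0
    rw [mem_parityPart_one] at h1
    rw [a.eq_add x, h0, h1.1, h1.2]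
    simp
  rw [DirectSum.isInternal_submodule_iff_isCompl _ (i := 0) (j := 1) (by decide)
    (by ext p; simpa using two p)]
  refine ⟨hd, codisjoint_iff_le_sup.2 fun x _ => ?_⟩
  have h2 : ((x.1, 0, x.2.2) : a.Carrier) ∈ parityPart a.grading 0 :=
    (a.mem_parityPart_zero _).2 rfl
  have h1 : ((0, x.2.1, 0) : a.Carrier) ∈ parityPart a.grading 1 :=
    (a.mem_parityPart_one _).2 ⟨rfl, rfl⟩
  have : x = (x.1, 0, x.2.2) + (0, x.2.1, 0) := by simp
  rw [this]
  exact Submodule.add_mem_sup h2 h1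

end FlatModel.GradedSubalgebra

/-! ### The graded Lie superalgebra `𝔞` and its deformations -/

namespace FlatModel.GradedSubalgebra

variable {V S : Type*} [AddCommGroup V] [Module ℝ V] [FiniteDimensional ℝ V]
  [AddCommGroup S] [Module ℝ S] {F : FlatModel V S} (a : F.GradedSubalgebra)

/-- `𝔞₀ = 𝔥 ⊕ 𝔯'` acting on `V` and `S'`, together with the Dirac current on `S'`. -/
def diracModule : DiracModule (a.h × a.r') V a.S' where
  ρV := a.h.incl.comp (LieHom.fst ℝ a.h a.r')
  ρS :=
    { toFun := fun X => (F.spin (X.1 : Module.End ℝ V) + (X.2 : Module.End ℝ S)).restrict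
        fun s hs => a.S'.add_mem (a.h_act _ X.1.2 s hs) (a.r'_act _ X.2.2 s hs)
      map_add' := fun X Y => by
        ext s
        simp
        abel
      map_smul' := fun k X => by
        ext s
        simp
      map_lie' := by
        rintro ⟨A, x⟩ ⟨B, y⟩
        ext s
        have hA := a.h_le A.2
        have hB := a.h_le B.2
        have hx := (a.r'_le x.2).1
        have hy := (a.r'_le y.2).1
        simp only [LieAlgebra.Prod.bracket_apply, LieSubalgebra.coe_bracket, F.spin_lie hA]
        simp [LieRing.of_associative_ring_bracket, hx _ hB, hy _ hA]
        abel }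
  κ := F.κ.compl₁₂ a.S'.subtype a.S'.subtype
  κ_symm s t := F.κ_symm s t
  κ_equivariant X s t := by
    have h1 := F.κ_spin (a.h_le X.1.2) s t
    have h2 := (a.r'_le X.2.2).2 s t
    simp only [LieHom.coe_comp, Function.comp_apply, LieHom.fst_apply, LieSubalgebra.coe_incl,
      LinearMap.compl₁₂_apply, Submodule.subtype_apply, LieHom.coe_mk, LinearMap.coe_restrict_apply,
      LinearMap.add_apply, map_add]
    linear_combination (norm := module) h1 - h2

@[simp]
theorem diracModule_ρV (X : a.h × a.r') (v : V) :
    a.diracModule.ρV X v = (X.1 : Module.End ℝ V) v := rfl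

@[simp]
theorem coe_diracModule_ρS (X : a.h × a.r') (s : a.S') :
    (a.diracModule.ρS X s : S) =
      F.spin (X.1 : Module.End ℝ V) s + (X.2 : Module.End ℝ S) s := rfl

@[simp]
theorem diracModule_κ (s t : a.S') : a.diracModule.κ s t = F.κ s t := rfl

/-- `𝔞₀` acts faithfully on `S'`: an element that kills `S'` has an `𝔰𝔬(V)`-component that kills
`κ(S', S')`, hence vanishes. -/
theorem diracModule_faithful {a : F.GradedSubalgebra} (ht : a.IsTransitive)
    (hspan : Submodule.span ℝ (Set.range fun s : a.S' => F.κ s s) = ⊤) (X : a.h × a.r')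
    (hX : ∀ s, a.diracModule.ρS X s = 0) : X = 0 := by
  have h1 : (X.1 : Module.End ℝ V) = 0 := by
    refine LinearMap.ext_on hspan ?_
    rintro _ ⟨s, rfl⟩
    have := a.diracModule.κ_equivariant X s s
    simpa [hX] using this
  have h2 : (X.2 : Module.End ℝ S) = 0 := ht _ X.2.2 fun s hs => by
    have := congrArg Subtype.val (hX ⟨s, hs⟩)
    simpa [h1] using this
  exact Prod.ext (Subtype.ext h1) (Subtype.ext h2)

theorem bracket_eq : a.bracket = a.diracModule.zeroCocycle.bracket 0 := by
  refine LinearMap.ext₂ fun x y => ?_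
  obtain ⟨v, s, A, r⟩ := x
  obtain ⟨w, t, B, r'⟩ := y
  rw [DiracModule.Cocycle.bracket_apply]
  refine Prod.ext ?_ (Prod.ext (Subtype.ext ?_) ?_)
  · simp [bracket, DiracModule.zeroCocycle]
  · simp [bracket, DiracModule.zeroCocycle]
    abel
  · simp [bracket, DiracModule.zeroCocycle]

theorem isLieSuperbracket_parityPart
    (hspan : Submodule.span ℝ (Set.range fun s : a.S' => F.κ s s) = ⊤)
    {c : a.diracModule.Cocycle} {δ : V →ₗ[ℝ] V →ₗ[ℝ] a.h × a.r'} (hδ : c.IsCurvature δ)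
    (hself : ∀ v, δ v v = 0) :
    IsLieSuperbracket (L := a.Carrier) (parityPart a.grading) (c.bracket δ) :=
  DiracModule.Cocycle.isLieSuperbracket (P := parityPart a.grading) hδ hself hspan
    a.parityPart_isInternal a.mem_parityPart_zero a.mem_parityPart_one

theorem isGradedLieSuperbracket
    (hspan : Submodule.span ℝ (Set.range fun s : a.S' => F.κ s s) = ⊤) :
    IsGradedLieSuperbracket a.grading a.bracket := by
  refine ⟨a.grading_isInternal, ?_, ?_⟩
  · rw [bracket_eq]
    exact a.isLieSuperbracket_parityPart hspan DiracModule.isCurvature_zero fun v => rfl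
  · rintro i j ⟨v, s, X⟩ hx ⟨w, t, Y⟩ hy
    rw [mem_grading] at hx hy
    obtain ⟨h1, h2, h3⟩ := hx
    obtain ⟨k1, k2, k3⟩ := hy
    simp only at h1 h2 h3 k1 k2 k3
    rw [bracket_eq, DiracModule.Cocycle.bracket_apply, mem_grading]
    simp only [DiracModule.zeroCocycle, LinearMap.zero_apply, add_zero, sub_zero]
    refine ⟨fun h => ?_, fun h => ?_, fun h => ?_⟩
    · have e1 : a.diracModule.ρV X w = 0 := by
        by_cases hi : i = 0
        · rw [k1 (by omega), map_zero]
        · rw [h3 hi, map_zero, LinearMap.zero_apply]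
      have e2 : a.diracModule.ρV Y v = 0 := by
        by_cases hj : j = 0
        · rw [h1 (by omega), map_zero]
        · rw [k3 hj, map_zero, LinearMap.zero_apply]
      have e3 : a.diracModule.κ s t = 0 := by
        by_cases hi : i = -1
        · rw [k2 (by omega), map_zero]
        · rw [h2 hi, map_zero, LinearMap.zero_apply]
      rw [e1, e2, e3, sub_zero, add_zero]
    · have e1 : a.diracModule.ρS X t = 0 := by
        by_cases hi : i = 0
        · rw [k2 (by omega), map_zero]
        · rw [h3 hi, map_zero, LinearMap.zero_apply]
      have e2 : a.diracModule.ρS Y s = 0 := by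
        by_cases hj : j = 0
        · rw [h2 (by omega), map_zero]
        · rw [k3 hj, map_zero, LinearMap.zero_apply]
      rw [e1, e2, sub_zero]
    · by_cases hi : i = 0
      · rw [k3 (by omega), lie_zero]
      · rw [h3 hi, zero_lie]

/-- A cocycle with a curvature integrates to a filtered deformation. -/
theorem isFilteredDeformation
    (hspan : Submodule.span ℝ (Set.range fun s : a.S' => F.κ s s) = ⊤)
    {c : a.diracModule.Cocycle} {δ : V →ₗ[ℝ] V →ₗ[ℝ] a.h × a.r'} (hδ : c.IsCurvature δ)
    (hself : ∀ v, δ v v = 0) : IsFilteredDeformation a.grading a.bracket (c.bracket δ) := by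
  refine .of_assocGraded (a.isGradedLieSuperbracket hspan)
    (a.isLieSuperbracket_parityPart hspan hδ hself) ?_
  rintro i j ⟨v, s, X⟩ hx ⟨w, t, Y⟩ hy
  rw [mem_grading] at hx hy
  obtain ⟨h1, h2, h3⟩ := hx
  obtain ⟨k1, k2, k3⟩ := hy
  simp only at h1 h2 h3 k1 k2 k3
  have e : c.bracket δ (v, s, X) (w, t, Y) - a.bracket (v, s, X) (w, t, Y) =
      (c.α v w, c.β v t - c.β w s, c.γ s t + c.τ X w - c.τ Y v + δ v w) := by
    rw [bracket_eq, DiracModule.Cocycle.bracket_apply, DiracModule.Cocycle.bracket_apply]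
    simp only [DiracModule.zeroCocycle, LinearMap.zero_apply, add_zero, sub_zero, Prod.mk_sub_mk,
      Prod.mk.injEq]
    refine ⟨?_, ?_, ?_⟩ <;> abel
  rw [e]
  apply a.mem_gradingFiltration
  · intro h
    by_cases hi : i = -2
    · simp only [k1 (by omega), map_zero]
    · simp only [h1 hi, map_zero, LinearMap.zero_apply]
  · intro h
    have e1 : c.β v t = 0 := by
      by_cases hi : i = -2
      · rw [k2 (by omega), map_zero]
      · rw [h1 hi, map_zero, LinearMap.zero_apply]
    have e2 : c.β w s = 0 := by
      by_cases hi : j = -2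
      · rw [h2 (by omega), map_zero]
      · rw [k1 hi, map_zero, LinearMap.zero_apply]
    simp only [e1, e2, sub_zero]
  · intro h
    have e1 : c.γ s t = 0 := by
      by_cases hi : i = -1
      · rw [k2 (by omega), map_zero]
      · rw [h2 hi, map_zero, LinearMap.zero_apply]
    have e2 : c.τ X w = 0 := by
      by_cases hi : i = 0
      · rw [k1 (by omega), map_zero]
      · rw [h3 hi, map_zero, LinearMap.zero_apply]
    have e3 : c.τ Y v = 0 := by
      by_cases hi : j = 0
      · rw [h1 (by omega), map_zero]
      · rw [k3 hi, map_zero, LinearMap.zero_apply]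
    have e4 : δ v w = 0 := by
      by_cases hi : i = -2
      · rw [k1 (by omega), map_zero]
      · rw [h1 hi, map_zero, LinearMap.zero_apply]
    simp only [e1, e2, e3, e4, add_zero, sub_zero]

/-! ### Components of a presentation -/

section Presentation

variable {a} {sp : F.Splitting} {μ : Z22 a a} {c : NormalisedCocycle sp} {l₁ : V →ₗ[ℝ] F.so}
  {l₂ : V →ₗ[ℝ] F.r}

namespace IsPresentation

theorem α_eq (h : a.IsPresentation μ c l₁ l₂) (v w : V) :
    μ.1.α v w = (l₁ v : Module.End ℝ V) w - (l₁ w : Module.End ℝ V) v := by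
  have := congrArg (fun x : Bil22 a F.full => x.α v w) h.eq
  simpa [pushBil, NormalisedCocycle.pull, d21] using this

theorem β_eq (h : a.IsPresentation μ c l₁ l₂) (v : V) (s : a.S') :
    (μ.1.β v s : S) = c.β v s + F.spin (l₁ v : Module.End ℝ V) s + (l₂ v : Module.End ℝ S) s := by
  have := congrArg (fun x : Bil22 a F.full => (x.β v s : S)) h.eq
  simp [pushBil, NormalisedCocycle.pull, d21] at this
  rw [this, add_assoc]

theorem γ_eq (h : a.IsPresentation μ c l₁ l₂) (s t : a.S') :
    (μ.1.γ s t : Module.End ℝ V) = c.γ s t - l₁ (F.κ s t) := by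
  have := congrArg (fun x : Bil22 a F.full => (x.γ s t : Module.End ℝ V)) h.eq
  simpa [pushBil, NormalisedCocycle.pull, d21, sub_eq_add_neg] using this

theorem ρ_eq (h : a.IsPresentation μ c l₁ l₂) (s t : a.S') :
    (μ.1.ρ s t : Module.End ℝ S) = c.ρ s t - l₂ (F.κ s t) := by
  have := congrArg (fun x : Bil22 a F.full => (x.ρ s t : Module.End ℝ S)) h.eq
  simpa [pushBil, NormalisedCocycle.pull, d21, sub_eq_add_neg] using this

theorem invariant_β (h : a.IsPresentation μ c l₁ l₂) (X : a.h × a.r') (v : V) (s : S) :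
    F.spin (X.1 : Module.End ℝ V) (c.β v s) + (X.2 : Module.End ℝ S) (c.β v s) =
      c.β ((X.1 : Module.End ℝ V) v) s +
        c.β v (F.spin (X.1 : Module.End ℝ V) s + (X.2 : Module.End ℝ S) s) := by
  have := congrArg (fun f => f s) ((h.invariant (⟨X.1, a.h_le X.1.2⟩, ⟨X.2, a.r'_le X.2.2⟩)
    X.1.2 X.2.2).1 v)
  simp only [NormalisedCocycle.actβ, actS, LinearMap.sub_apply, LinearMap.comp_apply,
    LinearMap.add_apply, LinearMap.zero_apply] at this
  linear_combination (norm := module) this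

theorem invariant_γ (h : a.IsPresentation μ c l₁ l₂) (X : a.h × a.r') (s t : S) :
    ⁅(X.1 : Module.End ℝ V), (c.γ s t : Module.End ℝ V)⁆ =
      c.γ (F.spin (X.1 : Module.End ℝ V) s + (X.2 : Module.End ℝ S) s) t +
        c.γ s (F.spin (X.1 : Module.End ℝ V) t + (X.2 : Module.End ℝ S) t) := by
  have := congrArg (fun f => (f s t : Module.End ℝ V))
    (h.invariant (⟨X.1, a.h_le X.1.2⟩, ⟨X.2, a.r'_le X.2.2⟩) X.1.2 X.2.2).2.1
  simp only [NormalisedCocycle.actγ, actS, LinearMap.sub_apply, LinearMap.compr₂_apply,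
    LinearMap.compl₁₂_apply, LinearMap.id_apply, LieAlgebra.ad_apply, AddSubgroupClass.coe_sub,
    LieSubalgebra.coe_bracket, LinearMap.add_apply, LinearMap.zero_apply,
    ZeroMemClass.coe_zero] at this
  linear_combination (norm := module) this

theorem invariant_ρ (h : a.IsPresentation μ c l₁ l₂) (X : a.h × a.r') (s t : S) :
    ⁅(X.2 : Module.End ℝ S), (c.ρ s t : Module.End ℝ S)⁆ =
      c.ρ (F.spin (X.1 : Module.End ℝ V) s + (X.2 : Module.End ℝ S) s) t +
        c.ρ s (F.spin (X.1 : Module.End ℝ V) t + (X.2 : Module.End ℝ S) t) := by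
  have := congrArg (fun f => (f s t : Module.End ℝ S))
    (h.invariant (⟨X.1, a.h_le X.1.2⟩, ⟨X.2, a.r'_le X.2.2⟩) X.1.2 X.2.2).2.2
  simp only [NormalisedCocycle.actρ, actS, LinearMap.sub_apply, LinearMap.compr₂_apply,
    LinearMap.compl₁₂_apply, LinearMap.id_apply, LieAlgebra.ad_apply, AddSubgroupClass.coe_sub,
    LieSubalgebra.coe_bracket, LinearMap.add_apply, LinearMap.zero_apply,
    ZeroMemClass.coe_zero] at this
  linear_combination (norm := module) this

end IsPresentation
end Presentation
end FlatModel.GradedSubalgebra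

/-! ### From presentations to cocycles with curvature -/

namespace FlatModel.GradedSubalgebra

variable {V S : Type*} [AddCommGroup V] [Module ℝ V] [FiniteDimensional ℝ V]
  [AddCommGroup S] [Module ℝ S] {F : FlatModel V S} {a : F.GradedSubalgebra}
  {sp : F.Splitting} {μ : Z22 a a} {c : NormalisedCocycle sp} {l₁ : V →ₗ[ℝ] F.so}
  {l₂ : V →ₗ[ℝ] F.r}

/-- A linear map with values in a submodule at all `κ(s, s)`, `s ∈ S'`, takes values in it. -/
theorem mem_of_span {M : Type*} [AddCommGroup M] [Module ℝ M] {N : Submodule ℝ M}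
    (hspan : Submodule.span ℝ (Set.range fun s : a.S' => F.κ s s) = ⊤) (f : V →ₗ[ℝ] M)
    (hf : ∀ s : a.S', f (F.κ s s) ∈ N) (v : V) : f v ∈ N := by
  have : (⊤ : Submodule ℝ V) ≤ N.comap f := by
    rw [← hspan, Submodule.span_le]
    rintro _ ⟨s, rfl⟩
    exact hf s
  exact this trivial

namespace IsPresentation

theorem γ_lie_eq (h : a.IsPresentation μ c l₁ l₂) (X : a.h × a.r') (s t : a.S') :
    ⁅(X.1 : Module.End ℝ V), (μ.1.γ s t : Module.End ℝ V)⁆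
      - μ.1.γ (a.diracModule.ρS X s) t - μ.1.γ s (a.diracModule.ρS X t) =
    -(⁅(X.1 : Module.End ℝ V), (l₁ (F.κ s t) : Module.End ℝ V)⁆
      - l₁ ((X.1 : Module.End ℝ V) (F.κ s t))) := by
  have e := congrArg (fun v => (l₁ v : Module.End ℝ V)) (a.diracModule.κ_equivariant X s t)
  simp only [diracModule_ρV, diracModule_κ, map_add, AddMemClass.coe_add] at e
  simp only [h.γ_eq, lie_sub, h.invariant_γ, coe_diracModule_ρS] at e ⊢
  linear_combination (norm := module) -e

theorem ρ_lie_eq (h : a.IsPresentation μ c l₁ l₂) (X : a.h × a.r') (s t : a.S') :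
    ⁅(X.2 : Module.End ℝ S), (μ.1.ρ s t : Module.End ℝ S)⁆
      - μ.1.ρ (a.diracModule.ρS X s) t - μ.1.ρ s (a.diracModule.ρS X t) =
    -(⁅(X.2 : Module.End ℝ S), (l₂ (F.κ s t) : Module.End ℝ S)⁆
      - l₂ ((X.1 : Module.End ℝ V) (F.κ s t))) := by
  have e := congrArg (fun v => (l₂ v : Module.End ℝ S)) (a.diracModule.κ_equivariant X s t)
  simp only [diracModule_ρV, diracModule_κ, map_add, AddMemClass.coe_add] at e
  simp only [h.ρ_eq, lie_sub, h.invariant_ρ, coe_diracModule_ρS] at e ⊢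
  linear_combination (norm := module) -e

/-- `X · λ₁` takes values in `𝔥`, because `X · γ` does and `κ(S', S')` spans `V`. -/
theorem τ_mem_h (h : a.IsPresentation μ c l₁ l₂)
    (hspan : Submodule.span ℝ (Set.range fun s : a.S' => F.κ s s) = ⊤) (X : a.h × a.r') (v : V) :
    ⁅(X.1 : Module.End ℝ V), (l₁ v : Module.End ℝ V)⁆ - l₁ ((X.1 : Module.End ℝ V) v) ∈ a.h := by
  refine mem_of_span (N := a.h.toSubmodule) hspan
    ((LieAlgebra.ad ℝ (Module.End ℝ V) X.1) ∘ₗ (F.so.toSubmodule.subtype ∘ₗ l₁)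
      - F.so.toSubmodule.subtype ∘ₗ l₁ ∘ₗ (X.1 : Module.End ℝ V)) (fun s => ?_) v
  have e := h.γ_lie_eq X s s
  rw [← neg_eq_iff_eq_neg] at e
  change ⁅(X.1 : Module.End ℝ V), (l₁ (F.κ s s) : Module.End ℝ V)⁆
    - l₁ ((X.1 : Module.End ℝ V) (F.κ s s)) ∈ a.h
  rw [← e]
  exact neg_mem (sub_mem (sub_mem (a.h.lie_mem X.1.2 (μ.1.γ s s).2) (SetLike.coe_mem _))
    (SetLike.coe_mem _))

/-- `X · λ₂` takes values in `𝔯'`, because `X · ρ` does and `κ(S', S')` spans `V`. -/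
theorem τ_mem_r (h : a.IsPresentation μ c l₁ l₂)
    (hspan : Submodule.span ℝ (Set.range fun s : a.S' => F.κ s s) = ⊤) (X : a.h × a.r') (v : V) :
    ⁅(X.2 : Module.End ℝ S), (l₂ v : Module.End ℝ S)⁆ - l₂ ((X.1 : Module.End ℝ V) v) ∈ a.r' := by
  refine mem_of_span (N := a.r'.toSubmodule) hspan
    ((LieAlgebra.ad ℝ (Module.End ℝ S) X.2) ∘ₗ (F.r.toSubmodule.subtype ∘ₗ l₂)
      - F.r.toSubmodule.subtype ∘ₗ l₂ ∘ₗ (X.1 : Module.End ℝ V)) (fun s => ?_) v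
  have e := h.ρ_lie_eq X s s
  rw [← neg_eq_iff_eq_neg] at e
  change ⁅(X.2 : Module.End ℝ S), (l₂ (F.κ s s) : Module.End ℝ S)⁆
    - l₂ ((X.1 : Module.End ℝ V) (F.κ s s)) ∈ a.r'
  rw [← e]
  exact neg_mem (sub_mem (sub_mem (a.r'.lie_mem X.2.2 (μ.1.ρ s s).2) (SetLike.coe_mem _))
    (SetLike.coe_mem _))

/-- The `𝔞`-valued cocycle `μ`, with `τ X = X · λ`. As `i_* μ - ∂λ` is the restriction of an
`𝔞₀`-invariant cocycle, `X · i_* μ = ∂(X · λ)`; in particular `X · λ` takes values in `𝔞₀`. -/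
def cocycle (h : a.IsPresentation μ c l₁ l₂)
    (hspan : Submodule.span ℝ (Set.range fun s : a.S' => F.κ s s) = ⊤) :
    a.diracModule.Cocycle where
  α := μ.1.α
  β := μ.1.β
  γ := LinearMap.mk₂ ℝ (fun s t => (μ.1.γ s t, μ.1.ρ s t)) (fun s s' t => by simp)
    (fun k s t => by simp) (fun s t t' => by simp) (fun k s t => by simp)
  τ := LinearMap.mk₂ ℝ (fun X v => (⟨_, h.τ_mem_h hspan X v⟩, ⟨_, h.τ_mem_r hspan X v⟩))
    (fun X Y v => by ext <;> simp <;> abel) (fun k X v => by ext <;> simp [smul_sub])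
    (fun X v w => by ext <;> simp <;> abel) (fun k X v => by ext <;> simp [smul_sub])
  α_self := μ.2.1.1
  γ_symm s t := Prod.ext (μ.2.1.2.1 s t) (μ.2.1.2.2 s t)
  cocycle₁ v s := μ.2.2.1 v s
  cocycle₂ s := Subtype.ext (by
    have e := μ.2.2.2 s
    rw [add_assoc] at e
    exact e)
  invariant_β X v s := Subtype.ext (by
    have e := h.invariant_β X v s
    have hA := a.h_le X.1.2
    have h1 := congrArg (fun f => f (s : S)) (F.spin_lie hA (l₁ v))
    have h2 := (a.r'_le X.2.2).1 _ (l₁ v).2 s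
    have h3 := (l₂ v).2.1 _ hA s
    simp only [LieRing.of_associative_ring_bracket, LinearMap.sub_apply,
      Module.End.mul_apply] at h1
    simp only [AddSubgroupClass.coe_sub, coe_diracModule_ρS, h.β_eq, LinearMap.mk₂_apply, map_add,
      diracModule_ρV, map_sub, LieRing.of_associative_ring_bracket, LinearMap.sub_apply,
      Module.End.mul_apply] at e h1 h2 h3 ⊢
    linear_combination (norm := module) e - h1 + h2 - h3)
  invariant_γ X s t := Prod.ext (Subtype.ext (h.γ_lie_eq X s t)) (Subtype.ext (h.ρ_lie_eq X s t))

/-- In `Θ₁` the component `β̂(v, s)` occurs only in the sum `β̂(v, s) + λ(v) s`, which is the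
`S'`-valued component `β` of `μ`. The rest is the first cocycle equation for `μ`. -/
theorem Θ₁_eq (h : a.IsPresentation μ c l₁ l₂) (v : V) (s : a.S') :
    (c.Θ₁ l₁ l₂ v s s : Module.End ℝ V) = (2 : ℝ) • (μ.1.γ s (μ.1.β v s) : Module.End ℝ V)
      + (⁅(μ.1.γ s s : Module.End ℝ V), (l₁ v : Module.End ℝ V)⁆
        - l₁ ((μ.1.γ s s : Module.End ℝ V) v))
      + l₁ (μ.1.α v (F.κ s s)) - ⁅(l₁ v : Module.End ℝ V), (l₁ (F.κ s s) : Module.End ℝ V)⁆ := by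
  have e := congrArg (fun v => (l₁ v : Module.End ℝ V)) (μ.2.2.1 v s)
  have hα : μ.1.α (F.κ s s) v = -μ.1.α v (F.κ s s) := by rw [h.α_eq, h.α_eq]; abel
  have hγ := c.γ_symm
  simp only [map_add, map_smul, hα, map_neg, map_zero, AddMemClass.coe_add, NegMemClass.coe_neg,
    SetLike.val_smul, ZeroMemClass.coe_zero] at e
  have e2 : (c.Θ₁ l₁ l₂ v s s : Module.End ℝ V) =
      (2 : ℝ) • (c.γ s (μ.1.β v s) : Module.End ℝ V) - ⁅(l₁ v : Module.End ℝ V),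
        (c.γ s s : Module.End ℝ V)⁆ := by
    rw [h.β_eq]
    simp [NormalisedCocycle.Θ₁, NormalisedCocycle.actγ, actS, hγ _ (s : S)]
    module
  have e3 := h.γ_eq s s
  have e4 := h.γ_eq s (μ.1.β v s)
  rw [e2, e4, eq_add_of_sub_eq e3.symm, lie_add, ← lie_skew (l₁ v : Module.End ℝ V) (μ.1.γ s s)]
  linear_combination (norm := module) e

/-- The analogue of `Θ₁_eq` for the R-symmetry component. -/
theorem Θ₂_eq (h : a.IsPresentation μ c l₁ l₂) (v : V) (s : a.S') :
    (c.Θ₂ l₁ l₂ v s s : Module.End ℝ S) = (2 : ℝ) • (μ.1.ρ s (μ.1.β v s) : Module.End ℝ S)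
      + (⁅(μ.1.ρ s s : Module.End ℝ S), (l₂ v : Module.End ℝ S)⁆
        - l₂ ((μ.1.γ s s : Module.End ℝ V) v))
      + l₂ (μ.1.α v (F.κ s s)) - ⁅(l₂ v : Module.End ℝ S), (l₂ (F.κ s s) : Module.End ℝ S)⁆ := by
  have e := congrArg (fun v => (l₂ v : Module.End ℝ S)) (μ.2.2.1 v s)
  have hα : μ.1.α (F.κ s s) v = -μ.1.α v (F.κ s s) := by rw [h.α_eq, h.α_eq]; abel
  have hρ := c.ρ_symm
  simp only [map_add, map_smul, hα, map_neg, map_zero, AddMemClass.coe_add, NegMemClass.coe_neg,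
    SetLike.val_smul, ZeroMemClass.coe_zero] at e
  have e2 : (c.Θ₂ l₁ l₂ v s s : Module.End ℝ S) =
      (2 : ℝ) • (c.ρ s (μ.1.β v s) : Module.End ℝ S) - ⁅(l₂ v : Module.End ℝ S),
        (c.ρ s s : Module.End ℝ S)⁆ := by
    rw [h.β_eq]
    simp [NormalisedCocycle.Θ₂, NormalisedCocycle.actρ, actS, hρ _ (s : S)]
    module
  have e3 := h.ρ_eq s s
  have e4 := h.ρ_eq s (μ.1.β v s)
  rw [e2, e4, eq_add_of_sub_eq e3.symm, lie_add, ← lie_skew (l₂ v : Module.End ℝ S) (μ.1.ρ s s)]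
  linear_combination (norm := module) e

/-- `δ = θ - λ ∘ α + [λ, λ]`. As `θ` takes values in `𝔰𝔬(V) ⊕ 𝔯` and `δ` in the subalgebra `𝔞₀`,
the equation is stated in `End V` and `End S`. -/
structure IsTwist (_ : a.IsPresentation μ c l₁ l₂) (θ₁ : V →ₗ[ℝ] V →ₗ[ℝ] F.so)
    (θ₂ : V →ₗ[ℝ] V →ₗ[ℝ] F.r) (δ : V →ₗ[ℝ] V →ₗ[ℝ] a.h × a.r') : Prop where
  fst : ∀ v w, ((δ v w).1 : Module.End ℝ V) = (θ₁ v w : Module.End ℝ V) - l₁ (μ.1.α v w)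
    + ⁅(l₁ v : Module.End ℝ V), (l₁ w : Module.End ℝ V)⁆
  snd : ∀ v w, ((δ v w).2 : Module.End ℝ S) = (θ₂ v w : Module.End ℝ S) - l₂ (μ.1.α v w)
    + ⁅(l₂ v : Module.End ℝ S), (l₂ w : Module.End ℝ S)⁆

/-- In terms of `δ`, the defining equation of `θ` is the Jacobi identity for `V, S, S`. -/
theorem IsTwist.definesTheta_iff {h : a.IsPresentation μ c l₁ l₂}
    {θ₁ : V →ₗ[ℝ] V →ₗ[ℝ] F.so} {θ₂ : V →ₗ[ℝ] V →ₗ[ℝ] F.r} {δ : V →ₗ[ℝ] V →ₗ[ℝ] a.h × a.r'}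
    (hδ : h.IsTwist θ₁ θ₂ δ)
    (hspan : Submodule.span ℝ (Set.range fun s : a.S' => F.κ s s) = ⊤) :
    c.DefinesTheta a l₁ l₂ θ₁ θ₂ ↔ ∀ v (s : a.S'), δ v (F.κ s s) =
      (2 : ℝ) • (h.cocycle hspan).γ s ((h.cocycle hspan).β v s)
        + (h.cocycle hspan).τ ((h.cocycle hspan).γ s s) v := by
  have key : ∀ v (s : a.S'), (θ₁ v (F.κ s s) = c.Θ₁ l₁ l₂ v s s ∧
      θ₂ v (F.κ s s) = c.Θ₂ l₁ l₂ v s s) ↔ δ v (F.κ s s) =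
      (2 : ℝ) • (h.cocycle hspan).γ s ((h.cocycle hspan).β v s)
        + (h.cocycle hspan).τ ((h.cocycle hspan).γ s s) v := by
    intro v s
    rw [Prod.ext_iff]
    refine and_congr ?_ ?_
    · rw [← Subtype.coe_inj, ← Subtype.coe_inj (b := Prod.fst _), h.Θ₁_eq, hδ.fst]
      change _ ↔ _ = (2 : ℝ) • (μ.1.γ s (μ.1.β v s) : Module.End ℝ V)
        + (⁅(μ.1.γ s s : Module.End ℝ V), (l₁ v : Module.End ℝ V)⁆
          - l₁ ((μ.1.γ s s : Module.End ℝ V) v))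
      constructor <;> intro e <;> linear_combination (norm := module) e
    · rw [← Subtype.coe_inj, ← Subtype.coe_inj (b := Prod.snd _), h.Θ₂_eq, hδ.snd]
      change _ ↔ _ = (2 : ℝ) • (μ.1.ρ s (μ.1.β v s) : Module.End ℝ S)
        + (⁅(μ.1.ρ s s : Module.End ℝ S), (l₂ v : Module.End ℝ S)⁆
          - l₂ ((μ.1.γ s s : Module.End ℝ V) v))
      constructor <;> intro e <;> linear_combination (norm := module) e
  exact ⟨fun H v s => (key v s).1 (H v s s.2), fun H v s hs => (key v ⟨s, hs⟩).2 (H v ⟨s, hs⟩)⟩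

/-- In terms of `δ`, the curvature equation for `θ` is the Jacobi identity for `V, V, S`. -/
theorem IsTwist.isCurvature {h : a.IsPresentation μ c l₁ l₂}
    {θ₁ : V →ₗ[ℝ] V →ₗ[ℝ] F.so} {θ₂ : V →ₗ[ℝ] V →ₗ[ℝ] F.r} {δ : V →ₗ[ℝ] V →ₗ[ℝ] a.h × a.r'}
    (hδ : h.IsTwist θ₁ θ₂ δ)
    (hspan : Submodule.span ℝ (Set.range fun s : a.S' => F.κ s s) = ⊤)
    (hθ : c.DefinesTheta a l₁ l₂ θ₁ θ₂) (hcurv : c.CurvatureEq a l₁ l₂ θ₁ θ₂) :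
    (h.cocycle hspan).IsCurvature δ := by
  refine ⟨(hδ.definesTheta_iff hspan).1 hθ, fun v w s => Subtype.ext ?_⟩
  change F.spin ((δ v w).1 : Module.End ℝ V) s + ((δ v w).2 : Module.End ℝ S) s =
    (μ.1.β v (μ.1.β w s) : S) - μ.1.β w (μ.1.β v s) - μ.1.β (μ.1.α v w) s
  have e := hcurv v w s s.2
  have h1 := congrArg (fun f => f (s : S)) (F.spin_lie (l₁ v).2 (l₁ w))
  have h2 := (l₂ v).2.1 _ (l₁ w).2 s
  have h3 := (l₂ w).2.1 _ (l₁ v).2 s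
  have h4 := congrArg (fun v => c.β v s) (h.α_eq v w)
  simp only [NormalisedCocycle.actβ, actS, LinearMap.sub_apply, LinearMap.comp_apply,
    LinearMap.add_apply, map_add, map_sub, LieRing.of_associative_ring_bracket,
    Module.End.mul_apply] at e h1 h2 h3 h4
  simp only [hδ.fst, hδ.snd, h.β_eq, map_add, map_sub, LinearMap.add_apply, LinearMap.sub_apply,
    LieRing.of_associative_ring_bracket, Module.End.mul_apply]
  linear_combination (norm := module) e + h1 - h2 + h3 + h4

/-- Maps `θ` that satisfy the defining equations lead to a correction `δ` with values in `𝔞₀`. -/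
theorem exists_isTwist (h : a.IsPresentation μ c l₁ l₂)
    (hspan : Submodule.span ℝ (Set.range fun s : a.S' => F.κ s s) = ⊤)
    {θ₁ : V →ₗ[ℝ] V →ₗ[ℝ] F.so} {θ₂ : V →ₗ[ℝ] V →ₗ[ℝ] F.r}
    (hθ : c.DefinesTheta a l₁ l₂ θ₁ θ₂) : ∃ δ, h.IsTwist θ₁ θ₂ δ := by
  have m1 : ∀ v w, (θ₁ v w : Module.End ℝ V) - l₁ (μ.1.α v w)
      + ⁅(l₁ v : Module.End ℝ V), (l₁ w : Module.End ℝ V)⁆ ∈ a.h := by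
    intro v w
    refine mem_of_span (N := a.h.toSubmodule) hspan (F.so.toSubmodule.subtype ∘ₗ (θ₁ v)
      - F.so.toSubmodule.subtype ∘ₗ l₁ ∘ₗ (μ.1.α v)
      + (LieAlgebra.ad ℝ (Module.End ℝ V) (l₁ v)) ∘ₗ (F.so.toSubmodule.subtype ∘ₗ l₁))
      (fun s => ?_) w
    change (θ₁ v (F.κ s s) : Module.End ℝ V) - l₁ (μ.1.α v (F.κ s s))
      + ⁅(l₁ v : Module.End ℝ V), (l₁ (F.κ s s) : Module.End ℝ V)⁆ ∈ a.h
    rw [(hθ v s s.2).1, h.Θ₁_eq]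
    convert add_mem (SMulMemClass.smul_mem (2 : ℝ) (μ.1.γ s (μ.1.β v s)).2)
      (h.τ_mem_h hspan (μ.1.γ s s, 0) v) using 1
    abel
  have m2 : ∀ v w, (θ₂ v w : Module.End ℝ S) - l₂ (μ.1.α v w)
      + ⁅(l₂ v : Module.End ℝ S), (l₂ w : Module.End ℝ S)⁆ ∈ a.r' := by
    intro v w
    refine mem_of_span (N := a.r'.toSubmodule) hspan (F.r.toSubmodule.subtype ∘ₗ (θ₂ v)
      - F.r.toSubmodule.subtype ∘ₗ l₂ ∘ₗ (μ.1.α v)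
      + (LieAlgebra.ad ℝ (Module.End ℝ S) (l₂ v)) ∘ₗ (F.r.toSubmodule.subtype ∘ₗ l₂))
      (fun s => ?_) w
    change (θ₂ v (F.κ s s) : Module.End ℝ S) - l₂ (μ.1.α v (F.κ s s))
      + ⁅(l₂ v : Module.End ℝ S), (l₂ (F.κ s s) : Module.End ℝ S)⁆ ∈ a.r'
    rw [(hθ v s s.2).2, h.Θ₂_eq]
    convert add_mem (SMulMemClass.smul_mem (2 : ℝ) (μ.1.ρ s (μ.1.β v s)).2)
      (h.τ_mem_r hspan (μ.1.γ s s, μ.1.ρ s s) v) using 1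
    abel
  exact ⟨LinearMap.mk₂ ℝ (fun v w => (⟨_, m1 v w⟩, ⟨_, m2 v w⟩))
    (fun v v' w => by ext <;> simp <;> abel) (fun k v w => by ext <;> simp [smul_sub, smul_add])
    (fun v w w' => by ext <;> simp <;> abel) (fun k v w => by ext <;> simp [smul_sub, smul_add]),
    ⟨fun v w => rfl, fun v w => rfl⟩⟩

/-- Conversely, every `δ` with values in `𝔞₀` comes from some `θ = δ + λ ∘ α - [λ, λ]`. -/
theorem exists_isTwist_of_curvature (h : a.IsPresentation μ c l₁ l₂)
    (δ : V →ₗ[ℝ] V →ₗ[ℝ] a.h × a.r') : ∃ θ₁ θ₂, h.IsTwist θ₁ θ₂ δ := by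
  exact ⟨LinearMap.mk₂ ℝ (fun v w => ⟨((δ v w).1 : Module.End ℝ V), a.h_le (δ v w).1.2⟩
      + l₁ (μ.1.α v w) - ⁅l₁ v, l₁ w⁆)
      (fun _ _ _ => Subtype.ext (by simp; abel))
      (fun _ _ _ => Subtype.ext (by simp [smul_sub, smul_add]))
      (fun _ _ _ => Subtype.ext (by simp; abel))
      (fun _ _ _ => Subtype.ext (by simp [smul_sub, smul_add])),
    LinearMap.mk₂ ℝ (fun v w => ⟨((δ v w).2 : Module.End ℝ S), a.r'_le (δ v w).2.2⟩
      + l₂ (μ.1.α v w) - ⁅l₂ v, l₂ w⁆)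
      (fun _ _ _ => Subtype.ext (by simp; abel))
      (fun _ _ _ => Subtype.ext (by simp [smul_sub, smul_add]))
      (fun _ _ _ => Subtype.ext (by simp; abel))
      (fun _ _ _ => Subtype.ext (by simp [smul_sub, smul_add])),
    ⟨fun v w => by simp; abel, fun v w => by simp; abel⟩⟩

end IsPresentation

/-- Two cocycles in the same class differ by the coboundary of some `ν : V → 𝔞₀`. -/
theorem exists_isShift (hspan : Submodule.span ℝ (Set.range fun s : a.S' => F.κ s s) = ⊤)
    {μ' : Z22 a a} {c' : NormalisedCocycle sp} {l₁' : V →ₗ[ℝ] F.so} {l₂' : V →ₗ[ℝ] F.r}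
    (h : a.IsPresentation μ c l₁ l₂) (h' : a.IsPresentation μ' c' l₁' l₂')
    (hcls : cls (le_refl a.S') μ = cls (le_refl a.S') μ') :
    ∃ ν, (h.cocycle hspan).IsShift (h'.cocycle hspan) ν := by
  rw [eq_comm, cls, Submodule.mkQ_apply, Submodule.mkQ_apply, Submodule.Quotient.eq] at hcls
  obtain ⟨l, hl⟩ := hcls
  have hl : μ'.1 = μ.1 + d21 (le_refl a.S') l := by
    rw [hl]
    simp
  refine ⟨l.1.prod l.2, fun v w => ?_, fun v s => Subtype.ext ?_, fun s t => ?_⟩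
  · change μ'.1.α v w = μ.1.α v w + (l.1 v : Module.End ℝ V) w - (l.1 w : Module.End ℝ V) v
    rw [hl, add_sub_assoc]
    rfl
  · rw [show (h'.cocycle hspan).β v s = μ'.1.β v s from rfl, hl]
    rfl
  · change (μ'.1.γ s t, μ'.1.ρ s t) = (μ.1.γ s t, μ.1.ρ s t) - (l.1 (F.κ s t), l.2 (F.κ s t))
    rw [hl, sub_eq_add_neg]
    rfl

end FlatModel.GradedSubalgebra

/-! ### The explicit bracket -/

namespace FlatModel.GradedSubalgebra

variable {V S : Type*} [AddCommGroup V] [Module ℝ V] [FiniteDimensional ℝ V]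
  [AddCommGroup S] [Module ℝ S] {F : FlatModel V S} {a : F.GradedSubalgebra}
  {sp : F.Splitting} {μ : Z22 a a} {c : NormalisedCocycle sp} {l₁ : V →ₗ[ℝ] F.so}
  {l₂ : V →ₗ[ℝ] F.r}

/-- The bracket built from the cocycle of a presentation and the correction `δ` has the explicit
components. -/
theorem IsPresentation.isExplicitBracket (h : a.IsPresentation μ c l₁ l₂)
    (hspan : Submodule.span ℝ (Set.range fun s : a.S' => F.κ s s) = ⊤)
    {θ₁ : V →ₗ[ℝ] V →ₗ[ℝ] F.so} {θ₂ : V →ₗ[ℝ] V →ₗ[ℝ] F.r} {δ : V →ₗ[ℝ] V →ₗ[ℝ] a.h × a.r'}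
    (hδ : h.IsTwist θ₁ θ₂ δ) :
    a.IsExplicitBracket c l₁ l₂ θ₁ θ₂ ((h.cocycle hspan).bracket δ) := by
  have hτ : ∀ X v, (h.cocycle hspan).τ X v =
    (⟨_, h.τ_mem_h hspan X v⟩, ⟨_, h.τ_mem_r hspan X v⟩) := fun X v => rfl
  have hγ : ∀ s t, (h.cocycle hspan).γ s t = (μ.1.γ s t, μ.1.ρ s t) := fun s t => rfl
  have hβ : (h.cocycle hspan).β = μ.1.β := rfl
  have hα : (h.cocycle hspan).α = μ.1.α := rfl
  have hV : ∀ v, a.inV v = (v, 0, 0, 0) := fun _ => rfl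
  have hS : ∀ s, a.inS s = (0, s, 0, 0) := fun _ => rfl
  have hH : ∀ A, a.inH A = (0, 0, A, 0) := fun _ => rfl
  have hR : ∀ x, a.inR x = (0, 0, 0, x) := fun _ => rfl
  constructor <;> intros <;>
    simp only [comps, hV, hS, hH, hR, DiracModule.Cocycle.bracket_apply]
  · simp [LieRing.of_associative_ring_bracket]
  · simp [LieRing.of_associative_ring_bracket]
  · simp
  · simp [hτ]
  · simp [hτ]
  · simp
  · simp
  · simp [hγ, h.γ_eq, h.ρ_eq]
  · simp [hβ, hτ, h.β_eq]
  · simp [hα, hτ, hδ.fst, hδ.snd, h.α_eq]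

/-- A super-skew bracket is determined by its explicit components. -/
theorem IsExplicitBracket.unique {θ₁ : V →ₗ[ℝ] V →ₗ[ℝ] F.so} {θ₂ : V →ₗ[ℝ] V →ₗ[ℝ] F.r}
    {b b' : a.Carrier →ₗ[ℝ] a.Carrier →ₗ[ℝ] a.Carrier}
    (hb : a.IsExplicitBracket c l₁ l₂ θ₁ θ₂ b) (hb' : a.IsExplicitBracket c l₁ l₂ θ₁ θ₂ b')
    (hl : IsLieSuperbracket (parityPart a.grading) b)
    (hl' : IsLieSuperbracket (parityPart a.grading) b') : b = b' := by
  have hinj : Function.Injective a.comps := by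
    rintro ⟨v, s, A, x⟩ ⟨w, t, B, y⟩ e
    simpa [comps, Prod.ext_iff] using e
  have hh : ∀ A B, b (a.inH A) (a.inH B) = b' (a.inH A) (a.inH B) := fun A B =>
    hinj ((hb.hh A B).trans (hb'.hh A B).symm)
  have hrr : ∀ A B, b (a.inR A) (a.inR B) = b' (a.inR A) (a.inR B) := fun A B =>
    hinj ((hb.rr A B).trans (hb'.rr A B).symm)
  have hhr : ∀ A B, b (a.inH A) (a.inR B) = b' (a.inH A) (a.inR B) := fun A B =>
    hinj ((hb.hr A B).trans (hb'.hr A B).symm)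
  have hhv : ∀ A B, b (a.inH A) (a.inV B) = b' (a.inH A) (a.inV B) := fun A B =>
    hinj ((hb.hv A B).trans (hb'.hv A B).symm)
  have hrv : ∀ A B, b (a.inR A) (a.inV B) = b' (a.inR A) (a.inV B) := fun A B =>
    hinj ((hb.rv A B).trans (hb'.rv A B).symm)
  have hhs : ∀ A B, b (a.inH A) (a.inS B) = b' (a.inH A) (a.inS B) := fun A B =>
    hinj ((hb.hs A B).trans (hb'.hs A B).symm)
  have hrs : ∀ A B, b (a.inR A) (a.inS B) = b' (a.inR A) (a.inS B) := fun A B =>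
    hinj ((hb.rs A B).trans (hb'.rs A B).symm)
  have hss : ∀ A B, b (a.inS A) (a.inS B) = b' (a.inS A) (a.inS B) := fun A B =>
    hinj ((hb.ss A B).trans (hb'.ss A B).symm)
  have hvs : ∀ A B, b (a.inV A) (a.inS B) = b' (a.inV A) (a.inS B) := fun A B =>
    hinj ((hb.vs A B).trans (hb'.vs A B).symm)
  have hvv : ∀ A B, b (a.inV A) (a.inV B) = b' (a.inV A) (a.inV B) := fun A B =>
    hinj ((hb.vv A B).trans (hb'.vv A B).symm)
  have hV : ∀ v, a.inV v ∈ parityPart a.grading 0 := fun v => (a.mem_parityPart_zero _).2 rfl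
  have hH : ∀ v, a.inH v ∈ parityPart a.grading 0 := fun v => (a.mem_parityPart_zero _).2 rfl
  have hR : ∀ v, a.inR v ∈ parityPart a.grading 0 := fun v => (a.mem_parityPart_zero _).2 rfl
  have hS : ∀ v, a.inS v ∈ parityPart a.grading 1 := fun v =>
    (a.mem_parityPart_one _).2 ⟨rfl, rfl⟩
  have swap : ∀ p q, ∀ x ∈ parityPart a.grading p, ∀ y ∈ parityPart a.grading q,
      b y x = b' y x → b x y = b' x y := fun p q x hx y hy e => by
    rw [hl.skew p q x hx y hy, hl'.skew p q x hx y hy, e]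
  refine LinearMap.ext₂ fun x y => ?_
  have dec : ∀ x : a.Carrier, x = a.inV x.1 + a.inS x.2.1 + a.inH x.2.2.1 + a.inR x.2.2.2 :=
    fun x => by simp [inV, inS, inH, inR]
  rw [dec x, dec y]
  simp only [map_add, LinearMap.add_apply, hh, hrr, hhr, hhv, hrv, hhs, hrs, hss, hvs, hvv,
    swap 0 0 _ (hV _) _ (hH _) (hhv _ _), swap 0 0 _ (hV _) _ (hR _) (hrv _ _),
    swap 1 0 _ (hS _) _ (hV _) (hvs _ _), swap 1 0 _ (hS _) _ (hH _) (hhs _ _),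
    swap 1 0 _ (hS _) _ (hR _) (hrs _ _), swap 0 0 _ (hR _) _ (hH _) (hhr _ _)]

theorem eq_of_definesTheta (hspan : Submodule.span ℝ (Set.range fun s : a.S' => F.κ s s) = ⊤)
    {θ₁ θ₁' : V →ₗ[ℝ] V →ₗ[ℝ] F.so} {θ₂ θ₂' : V →ₗ[ℝ] V →ₗ[ℝ] F.r}
    (h : c.DefinesTheta a l₁ l₂ θ₁ θ₂) (h' : c.DefinesTheta a l₁ l₂ θ₁' θ₂') :
    θ₁ = θ₁' ∧ θ₂ = θ₂' := by
  constructor <;> refine LinearMap.ext fun v => LinearMap.ext_on hspan ?_ <;> rintro _ ⟨s, rfl⟩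
  · exact (h v s s.2).1.trans (h' v s s.2).1.symm
  · exact (h v s s.2).2.trans (h' v s s.2).2.symm

end FlatModel.GradedSubalgebra

end

theorem mainTheorem3 {V S : Type*} [AddCommGroup V] [Module ℝ V] [FiniteDimensional ℝ V]
    [AddCommGroup S] [Module ℝ S] [FiniteDimensional ℝ S]
    (F : FlatModel V S) (hLor : F.IsLorentzian) (hdim : 2 < Module.finrank ℝ V)
    (hcausal : F.IsCausal) (sp : F.Splitting)
    (a : F.GradedSubalgebra) (hsusy : a.IsHighlySupersymmetric) (htrans : a.IsTransitive)
    (x : FlatModel.GradedSubalgebra.H22 (le_refl a.S'))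
    (hadm : a.IsAdmissible sp x) (hint : a.IsIntegrable sp x)
    (μ : FlatModel.GradedSubalgebra.Z22 a a)
    (hμ : FlatModel.GradedSubalgebra.cls (le_refl a.S') μ = x)
    (c : FlatModel.NormalisedCocycle sp) (l₁ : V →ₗ[ℝ] F.so) (l₂ : V →ₗ[ℝ] F.r)
    (hpres : a.IsPresentation μ c l₁ l₂) :
    (∃! θ : (V →ₗ[ℝ] V →ₗ[ℝ] F.so) × (V →ₗ[ℝ] V →ₗ[ℝ] F.r),
      c.DefinesTheta a l₁ l₂ θ.1 θ.2) ∧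
    ∀ (θ₁ : V →ₗ[ℝ] V →ₗ[ℝ] F.so) (θ₂ : V →ₗ[ℝ] V →ₗ[ℝ] F.r),
      c.DefinesTheta a l₁ l₂ θ₁ θ₂ →
      (∀ v, θ₁ v v = 0) ∧ (∀ v, θ₂ v v = 0) ∧
      ∃! b : a.Carrier →ₗ[ℝ] a.Carrier →ₗ[ℝ] a.Carrier,
        a.IsExplicitBracket c l₁ l₂ θ₁ θ₂ b ∧ IsFilteredDeformation a.grading a.bracket b := by
  have hspan := hcausal.span_κ_eq_top hLor hdim hsusy
  -- the curvature of the presentation that is integrable, transported to the given presentation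
  obtain ⟨μ₀, c₀, l₁₀, l₂₀, hμ₀, hpres₀, -, θ₁₀, θ₂₀, hθ₀, hcurv₀⟩ := hint
  obtain ⟨δ₀, hδ₀⟩ := hpres₀.exists_isTwist hspan hθ₀
  obtain ⟨ν, hν⟩ := FlatModel.GradedSubalgebra.exists_isShift hspan hpres₀ hpres (hμ₀.trans hμ.symm)
  obtain ⟨δ, hδ⟩ := hν.exists_isCurvature hspan (hδ₀.isCurvature hspan hθ₀ hcurv₀)
  obtain ⟨θ₁, θ₂, hθδ⟩ := hpres.exists_isTwist_of_curvature δ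
  have hθ := (hθδ.definesTheta_iff hspan).2 hδ.apply_κ
  have hself := hδ.self_eq_zero
    (FlatModel.GradedSubalgebra.diracModule_faithful htrans hspan)
  refine ⟨⟨(θ₁, θ₂), hθ, fun θ h => ?_⟩, fun θ₁' θ₂' hθ' => ?_⟩
  · obtain ⟨e₁, e₂⟩ := FlatModel.GradedSubalgebra.eq_of_definesTheta hspan h hθ
    exact Prod.ext e₁ e₂
  · obtain ⟨rfl, rfl⟩ := FlatModel.GradedSubalgebra.eq_of_definesTheta hspan hθ' hθ
    have hα : ∀ v, μ.1.α v v = 0 := μ.2.1.1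
    refine ⟨fun v => Subtype.ext ?_, fun v => Subtype.ext ?_,
      (hpres.cocycle hspan).bracket δ,
      ⟨hpres.isExplicitBracket hspan hθδ, a.isFilteredDeformation hspan hδ hself⟩,
      fun b hb => hb.1.unique (hpres.isExplicitBracket hspan hθδ) hb.2.lie
        (a.isLieSuperbracket_parityPart hspan hδ hself)⟩
    · simpa [hself, hα, eq_comm] using hθδ.fst v v
    · simpa [hself, hα, eq_comm] using hθδ.snd v v
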